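/- Let $\mathbf F$ be $\mathbf R$ or $\mathbf C$, let $n\ge 1$, and let $\mathbf P(\mathbf F^n)$ be the space of lines through $0$ in $\mathbf F^n$, with its usual manifold structure given by affine charts. Let $$X=\{(x,[y])\in\mathbf F^n\times\mathbf P(\mathbf F^n) : x_jy_k=x_ky_j\ \text{for all } j,k\},\qquad q_X\colon X\to\mathbf F^n,\quad q_X(x,[y])=x,$$ with its manifold structure given by the charts on $\{y_j\ne0\}$ with coordinates $x_j$ and $y_i/y_j$ ($i\neq j$). For a map $h$ between neighbourhoods of $0$ in $\mathbf F^n$ which is injective, fixes $0$, and has invertible $\mathbf F$-linear derivative $Dh|_0$, let $\widehat h$ be its lift to the parts of $X$ over these neighbourhoods: $\widehat h(x,[x])=(h(x),[h(x)])$ for $x\ne0$ and $\widehat h(0,[y])=(0,[Dh|_0(y)])$. Let $M$ be a (Hausdorff) manifold modelled on $\mathbf F^n$, smooth ($C^\infty$) if $\mathbf F=\mathbf R$ and complex (holomorphic) if $\mathbf F=\mathbf C$, and let $p\in M$. "Isomorphism" means $C^\infty$ diffeomorphism if $\mathbf F=\mathbf R$ and biholomorphism if $\mathbf F=\mathbf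 C$. Then there are a (Hausdorff) manifold $\widehat M$ of the same kind, modelled on $\mathbf F^n$ and second countable if $M$ is, and a smooth (respectively holomorphic) map $q\colon\widehat M\to M$, such that with $\Sigma=q^{-1}(\{p\})$: 1. $q$ is a quotient map, $\Sigma$ is nonempty, connected and compact, and $q$ restricts to a homeomorphism $\widehat M\setminus\Sigma\to M\setminus\{p\}$, that is, $q$ is a topological blowup of $M$ at $p$; 2. this restriction $q|\colon\widehat M\setminus\Sigma\to M\setminus\{p\}$ is an isomorphism of manifolds; 3. $\Sigma\cong\mathbf P(\mathbf F^n)$: there is a smooth (respectively holomorphic) embedding $\mathbf P(\mathbf F^n)\to\widehat M$ with image $\Sigma$; 4. $\widehat M$ is glued from the model $X$ by lifted coordinate changes: to every chart $\varphi\colon U\to\varphi(U)\subseteq\mathbf F^n$ of $M$ with $p\in U$ and $\varphi(p)=0$ one can assign an isomorphism $\Phi_\varphi\colon q^{-1}(U)\to q_X^{-1}(\varphi(U))$ with $q_X\circ\Phi_\varphi=\varphi\circ q$, in such a way that for any two such charts $\varphi\colon U\to\mathbf F^n$ and $\psi\colon U'\to\mathbf F^n$ $$\Phi_\psi\circ\Phi_\varphi^{-1}=\widehat{\psi\circ\varphi^{-1}}\quad\text{on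 } q_X^{-1}(\varphi(U\cap U')).$$ -/

import Mathlib

open Set Topology Manifold
open TopologicalSpace (Opens)
open scoped ContDiff LinearAlgebra.Projectivization

universe u v

noncomputable section

/-! ### Topological blowups -/

/-- A continuous map `q : V → M` of topological spaces is a topological blowup of `M` at `p` if it
is a quotient map, the exceptional locus `q ⁻¹' {p}` is nonempty, connected and compact, and `q`
restricts to a homeomorphism `V ∖ q ⁻¹' {p} → M ∖ {p}`.  (Recall that `IsConnected` includes
nonemptiness.  That `V` and `M` are manifolds of the same dimension is recorded separately, by
charted space structures over the same model.) -/
structure IsTopologicalBlowup {V M : Type*} [TopologicalSpace V] [TopologicalSpace M]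
    (q : V → M) (p : M) : Prop where
  isQuotientMap : IsQuotientMap q
  isConnected : IsConnected (q ⁻¹' {p})
  isCompact : IsCompact (q ⁻¹' {p})
  isHomeomorph : IsHomeomorph (({p}ᶜ : Set M).restrictPreimage q)

/-! ### The projective space `P(𝕜ⁿ⁺¹)` as a manifold -/

namespace Projectivization

section
variable {𝕜 : Type*} [RCLike 𝕜] {n : ℕ}

/-- The quotient topology on the projectivization of a topological vector space. -/
instance instQuotientTopology (K W : Type*) [DivisionRing K] [AddCommGroup W] [Module K W]
    [TopologicalSpace W] : TopologicalSpace (ℙ K W) :=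
  inferInstanceAs (TopologicalSpace (Quotient (projectivizationSetoid K W)))

theorem isQuotientMap_mk' (K W : Type*) [DivisionRing K] [AddCommGroup W] [Module K W]
    [TopologicalSpace W] : IsQuotientMap (Projectivization.mk' K : {w : W // w ≠ 0} → ℙ K W) :=
  isQuotientMap_quotient_mk'

theorem rep_mk_spec (y : EuclideanSpace 𝕜 (Fin n)) (hy : y ≠ 0) :
    ∃ a : 𝕜, a ≠ 0 ∧ ∀ i, (mk 𝕜 y hy).rep i = a * y i := by
  obtain ⟨a, ha⟩ := exists_smul_eq_mk_rep 𝕜 y hy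
  refine ⟨a, a.ne_zero, fun i => ?_⟩
  rw [← ha]
  rfl

theorem rep_mk_ne_zero_iff (y : EuclideanSpace 𝕜 (Fin n)) (hy : y ≠ 0) (i : Fin n) :
    (mk 𝕜 y hy).rep i ≠ 0 ↔ y i ≠ 0 := by
  obtain ⟨a, ha, h⟩ := rep_mk_spec y hy
  simp [h, ha]

theorem rep_mk_div (y : EuclideanSpace 𝕜 (Fin n)) (hy : y ≠ 0) (i j : Fin n) :
    (mk 𝕜 y hy).rep i / (mk 𝕜 y hy).rep j = y i / y j := by
  obtain ⟨a, ha, h⟩ := rep_mk_spec y hy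
  rw [h, h, mul_div_mul_left _ _ ha]

theorem exists_rep_ne_zero (l : ℙ 𝕜 (EuclideanSpace 𝕜 (Fin n))) : ∃ j, l.rep j ≠ 0 := by
  by_contra! h
  exact l.rep_nonzero (by ext i; simpa using h i)

/-- The vector `(w₀, …, 1, …, wₙ₋₁)` with `1` inserted in position `j`. -/
def insertOne (j : Fin (n + 1)) (w : EuclideanSpace 𝕜 (Fin n)) : EuclideanSpace 𝕜 (Fin (n + 1)) :=
  WithLp.toLp 2 (j.insertNth (1 : 𝕜) (fun i => w i) : Fin (n + 1) → 𝕜)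

@[simp] theorem insertOne_self (j : Fin (n + 1)) (w : EuclideanSpace 𝕜 (Fin n)) :
    insertOne j w j = 1 := by
  simp [insertOne]

@[simp] theorem insertOne_succAbove (j : Fin (n + 1)) (w : EuclideanSpace 𝕜 (Fin n)) (i : Fin n) :
    insertOne j w (j.succAbove i) = w i := by
  simp [insertOne]

theorem insertOne_ne_zero (j : Fin (n + 1)) (w : EuclideanSpace 𝕜 (Fin n)) :
    insertOne j w ≠ 0 := fun h => by
  have := insertOne_self j w
  rw [h] at this
  simp at this

theorem contDiff_insertOne (j : Fin (n + 1)) (k : ℕ∞ω) :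
    ContDiff 𝕜 k (insertOne (𝕜 := 𝕜) j) := by
  rw [contDiff_euclidean]
  intro i
  cases i using j.succAboveCases with
  | x => simpa using contDiff_const
  | p i =>
    simp only [insertOne_succAbove]
    exact contDiff_euclidean.1 contDiff_id i

theorem continuous_affineInv (j : Fin (n + 1)) :
    Continuous fun w : EuclideanSpace 𝕜 (Fin n) => mk 𝕜 (insertOne j w) (insertOne_ne_zero j w) :=
  (isQuotientMap_mk' 𝕜 _).continuous.comp
    (((contDiff_insertOne (𝕜 := 𝕜) j 0).continuous).subtype_mk (insertOne_ne_zero j))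

theorem isOpen_rep_ne_zero (j : Fin n) :
    IsOpen {l : ℙ 𝕜 (EuclideanSpace 𝕜 (Fin n)) | l.rep j ≠ 0} := by
  rw [← (isQuotientMap_mk' 𝕜 _).isOpen_preimage]
  have : (Projectivization.mk' 𝕜 ⁻¹' {l : ℙ 𝕜 (EuclideanSpace 𝕜 (Fin n)) | l.rep j ≠ 0})
      = {y | y.1 j ≠ 0} := by
    ext y
    exact rep_mk_ne_zero_iff y.1 y.2 j
  rw [this]
  exact isOpen_ne_fun (by fun_prop) continuous_const

theorem continuousOn_rep_div (i j : Fin n) :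
    ContinuousOn (fun l : ℙ 𝕜 (EuclideanSpace 𝕜 (Fin n)) => l.rep i / l.rep j)
      {l | l.rep j ≠ 0} := by
  rw [(isQuotientMap_mk' 𝕜 _).continuousOn_isOpen_iff (isOpen_rep_ne_zero j)]
  have : ContinuousOn (fun y : {y : EuclideanSpace 𝕜 (Fin n) // y ≠ 0} => y.1 i / y.1 j)
      {y | y.1 j ≠ 0} :=
    ContinuousOn.div (by fun_prop) (by fun_prop) (fun y hy => hy)
  refine (this.mono fun y hy => ?_).congr fun y _ => rep_mk_div y.1 y.2 i j
  exact (rep_mk_ne_zero_iff y.1 y.2 j).1 hy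

/-- The standard affine chart `[y₀, …, yₙ] ↦ (yᵢ / yⱼ)_{i ≠ j}` of projective space, defined on
`{yⱼ ≠ 0}`; its inverse inserts `1` in position `j`. -/
def affineChart (𝕜 : Type*) [RCLike 𝕜] (n : ℕ) (j : Fin (n + 1)) :
    OpenPartialHomeomorph (ℙ 𝕜 (EuclideanSpace 𝕜 (Fin (n + 1)))) (EuclideanSpace 𝕜 (Fin n)) where
  toFun l := WithLp.toLp 2 fun i => l.rep (j.succAbove i) / l.rep j
  invFun w := mk 𝕜 (insertOne j w) (insertOne_ne_zero j w)
  source := {l | l.rep j ≠ 0}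
  target := univ
  map_source' _ _ := mem_univ _
  map_target' w _ := (rep_mk_ne_zero_iff _ _ j).2 (by simp)
  left_inv' l hl := by
    conv_rhs => rw [← l.mk_rep]
    rw [mk_eq_mk_iff']
    refine ⟨(l.rep j)⁻¹, ?_⟩
    ext i
    cases i using j.succAboveCases with
    | x => simpa using inv_mul_cancel₀ hl
    | p i => simp [div_eq_inv_mul]
  right_inv' w _ := by
    ext i
    simp [rep_mk_div]
  open_source := isOpen_rep_ne_zero j
  open_target := isOpen_univ
  continuousOn_toFun :=
    (PiLp.continuous_toLp 2 _).comp_continuousOn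
      (continuousOn_pi.2 fun i => continuousOn_rep_div (j.succAbove i) j)
  continuousOn_invFun := (continuous_affineInv j).continuousOn

/-- The projective space `P(𝕜ⁿ⁺¹)`, with its atlas of affine charts. -/
instance instChartedSpace :
    ChartedSpace (EuclideanSpace 𝕜 (Fin n)) (ℙ 𝕜 (EuclideanSpace 𝕜 (Fin (n + 1)))) where
  atlas := range (affineChart 𝕜 n)
  chartAt l := affineChart 𝕜 n (exists_rep_ne_zero l).choose
  mem_chart_source l := (exists_rep_ne_zero l).choose_spec
  chart_mem_atlas _ := mem_range_self _

instance instIsManifold :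
    IsManifold 𝓘(𝕜, EuclideanSpace 𝕜 (Fin n)) ∞ (ℙ 𝕜 (EuclideanSpace 𝕜 (Fin (n + 1)))) := by
  refine isManifold_of_contDiffOn _ _ _ ?_
  rintro _ _ ⟨j, rfl⟩ ⟨k, rfl⟩
  have h (i : Fin (n + 1)) : ContDiff 𝕜 ∞ fun w : EuclideanSpace 𝕜 (Fin n) => insertOne j w i :=
    contDiff_euclidean.1 (contDiff_insertOne (𝕜 := 𝕜) j ∞) i
  have key : ContDiffOn 𝕜 ∞ (fun w : EuclideanSpace 𝕜 (Fin n) =>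
      WithLp.toLp 2 fun i => insertOne j w (k.succAbove i) / insertOne j w k)
      {w | insertOne j w k ≠ 0} := by
    rw [contDiffOn_euclidean]
    exact fun i => (h _).contDiffOn.div (h _).contDiffOn fun w hw => hw
  refine (key.mono ?_).congr ?_
  · rintro w hw
    simp only [mfld_simps] at hw
    exact (rep_mk_ne_zero_iff _ _ _).1 hw.2
  · intro w _
    ext i
    exact rep_mk_div _ _ _ _

end

end Projectivization

/-! ### The model blowup `X` of the origin in `𝕜ᵐ` -/

/-- The model `X = {(x, [y]) | xⱼ yₖ = xₖ yⱼ for all j, k} ⊆ 𝕜ᵐ × P(𝕜ᵐ)`.  (The condition does not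
depend on the representative `y`, see `BlowupModel.mem_iff`.) -/
def BlowupModel (𝕜 : Type*) [RCLike 𝕜] (m : ℕ) : Type _ :=
  {z : EuclideanSpace 𝕜 (Fin m) × ℙ 𝕜 (EuclideanSpace 𝕜 (Fin m)) //
    ∀ j k, z.1 j * z.2.rep k = z.1 k * z.2.rep j}

namespace BlowupModel

open Projectivization

section
variable {𝕜 : Type*} [RCLike 𝕜] {m n : ℕ}

/-- The subspace topology from `𝕜ᵐ × P(𝕜ᵐ)`. -/
instance : TopologicalSpace (BlowupModel 𝕜 m) :=
  inferInstanceAs (TopologicalSpace (Subtype _))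

theorem mem_iff (x y : EuclideanSpace 𝕜 (Fin m)) (hy : y ≠ 0) :
    (∀ j k, x j * (mk 𝕜 y hy).rep k = x k * (mk 𝕜 y hy).rep j) ↔
      ∀ j k, x j * y k = x k * y j := by
  obtain ⟨a, ha, h⟩ := rep_mk_spec y hy
  refine forall₂_congr fun j k => ?_
  rw [h, h, mul_left_comm, mul_left_comm (x k), mul_right_inj' ha]

/-- The blowdown map `q : X → 𝕜ᵐ`, `(x, [y]) ↦ x`. -/
def blowdown (z : BlowupModel 𝕜 m) : EuclideanSpace 𝕜 (Fin m) := z.1.1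

/-- The second projection `X → P(𝕜ᵐ)`, `(x, [y]) ↦ [y]`. -/
def line (z : BlowupModel 𝕜 m) : ℙ 𝕜 (EuclideanSpace 𝕜 (Fin m)) := z.1.2

theorem continuous_blowdown : Continuous (blowdown : BlowupModel 𝕜 m → _) :=
  continuous_fst.comp continuous_subtype_val

theorem continuous_line : Continuous (line : BlowupModel 𝕜 m → _) :=
  continuous_snd.comp continuous_subtype_val

/-- The point `(x, [y])` of `X`, for `y ≠ 0` and `x = μ y`. -/
def ofSMul (μ : 𝕜) (y : EuclideanSpace 𝕜 (Fin m)) (hy : y ≠ 0) : BlowupModel 𝕜 m :=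
  ⟨(μ • y, mk 𝕜 y hy), (mem_iff _ _ hy).2 fun j k => by
    simp only [PiLp.smul_apply, smul_eq_mul]; ring⟩

theorem blowdown_eq (z : BlowupModel 𝕜 m) (i j : Fin m) (hj : z.line.rep j ≠ 0) :
    z.blowdown i = z.blowdown j * (z.line.rep i / z.line.rep j) := by
  have := z.2 i j
  rw [← mul_div_assoc, eq_div_iff hj]
  exact this

/-- The vector `w` with its `j`-th coordinate replaced by `1`. -/
def replaceOne (j : Fin m) (w : EuclideanSpace 𝕜 (Fin m)) : EuclideanSpace 𝕜 (Fin m) :=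
  WithLp.toLp 2 fun i => if i = j then 1 else w i

@[simp] theorem replaceOne_apply (j i : Fin m) (w : EuclideanSpace 𝕜 (Fin m)) :
    replaceOne j w i = if i = j then 1 else w i := rfl

theorem replaceOne_ne_zero (j : Fin m) (w : EuclideanSpace 𝕜 (Fin m)) :
    replaceOne j w ≠ 0 := fun h => by
  have : replaceOne j w j = 1 := by simp
  rw [h] at this
  simp at this

theorem contDiff_replaceOne (j : Fin m) (k : ℕ∞ω) :
    ContDiff 𝕜 k (replaceOne (𝕜 := 𝕜) j) := by
  rw [contDiff_euclidean]
  intro i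
  simp only [replaceOne_apply]
  split_ifs
  · exact contDiff_const
  · exact contDiff_euclidean.1 contDiff_id i

/-- The standard chart of `X` on `{yⱼ ≠ 0}`: the point `(x, [y])` goes to the vector with `j`-th
coordinate `xⱼ` and `i`-th coordinate `yᵢ / yⱼ` for `i ≠ j`.  Its inverse sends `w` to
`(wⱼ y, [y])`, where `y` is `w` with its `j`-th coordinate replaced by `1`. -/
def chart (𝕜 : Type*) [RCLike 𝕜] (m : ℕ) (j : Fin m) :
    OpenPartialHomeomorph (BlowupModel 𝕜 m) (EuclideanSpace 𝕜 (Fin m)) where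
  toFun z := WithLp.toLp 2 fun i => if i = j then z.blowdown j else z.line.rep i / z.line.rep j
  invFun w := ofSMul (w j) (replaceOne j w) (replaceOne_ne_zero j w)
  source := {z | z.line.rep j ≠ 0}
  target := univ
  map_source' _ _ := mem_univ _
  map_target' w _ := (rep_mk_ne_zero_iff _ _ j).2 (by simp)
  left_inv' z hz := by
    have hz' : z.line.rep j ≠ 0 := hz
    refine Subtype.ext (Prod.ext ?_ ?_)
    · ext i
      change _ = z.blowdown i
      rw [blowdown_eq z i j hz']
      by_cases hi : i = j
      · subst hi
        simp [ofSMul, hz']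
      · simp [ofSMul, hi]
    · change Projectivization.mk 𝕜 _ _ = z.line
      conv_rhs => rw [← z.line.mk_rep]
      rw [mk_eq_mk_iff']
      refine ⟨(z.line.rep j)⁻¹, ?_⟩
      ext i
      by_cases hi : i = j
      · subst hi
        simpa using inv_mul_cancel₀ hz'
      · simp [hi, div_eq_inv_mul]
  right_inv' w _ := by
    ext i
    by_cases hi : i = j
    · subst hi
      simp [ofSMul, blowdown]
    · simp [ofSMul, line, hi, rep_mk_div]
  open_source := (isOpen_rep_ne_zero j).preimage continuous_line
  open_target := isOpen_univ
  continuousOn_toFun := by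
    refine (PiLp.continuous_toLp 2 _).comp_continuousOn (continuousOn_pi.2 fun i => ?_)
    by_cases hi : i = j
    · simp only [hi, if_true]
      exact ((EuclideanSpace.proj (𝕜 := 𝕜) j).continuous.comp continuous_blowdown).continuousOn
    · simp only [hi, if_false]
      exact (continuousOn_rep_div i j).comp continuous_line.continuousOn fun z hz => hz
  continuousOn_invFun := by
    refine Continuous.continuousOn (Continuous.subtype_mk (Continuous.prodMk ?_ ?_) _)
    · exact ((EuclideanSpace.proj (𝕜 := 𝕜) j).continuous).smul
        (contDiff_replaceOne (𝕜 := 𝕜) j 0).continuous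
    · exact (isQuotientMap_mk' 𝕜 _).continuous.comp
        ((contDiff_replaceOne (𝕜 := 𝕜) j 0).continuous.subtype_mk (replaceOne_ne_zero j))

instance : ChartedSpace (EuclideanSpace 𝕜 (Fin m)) (BlowupModel 𝕜 m) where
  atlas := range (chart 𝕜 m)
  chartAt z := chart 𝕜 m (exists_rep_ne_zero z.line).choose
  mem_chart_source z := (exists_rep_ne_zero z.line).choose_spec
  chart_mem_atlas _ := mem_range_self _

instance : IsManifold 𝓘(𝕜, EuclideanSpace 𝕜 (Fin m)) ∞ (BlowupModel 𝕜 m) := by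
  refine isManifold_of_contDiffOn _ _ _ ?_
  rintro _ _ ⟨j, rfl⟩ ⟨k, rfl⟩
  have h (i : Fin m) : ContDiff 𝕜 ∞ fun w : EuclideanSpace 𝕜 (Fin m) => replaceOne j w i :=
    contDiff_euclidean.1 (contDiff_replaceOne (𝕜 := 𝕜) j ∞) i
  have h' : ContDiff 𝕜 ∞ fun w : EuclideanSpace 𝕜 (Fin m) => w j :=
    contDiff_euclidean.1 contDiff_id j
  have key : ContDiffOn 𝕜 ∞ (fun w : EuclideanSpace 𝕜 (Fin m) =>
      WithLp.toLp 2 fun i =>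
        if i = k then w j * replaceOne j w k else replaceOne j w i / replaceOne j w k)
      {w | replaceOne j w k ≠ 0} := by
    rw [contDiffOn_euclidean]
    intro i
    by_cases hi : i = k
    · simp only [hi, if_true]
      exact (h'.mul (h k)).contDiffOn
    · simp only [hi, if_false]
      exact (h _).contDiffOn.div (h _).contDiffOn fun w hw => hw
  refine (key.mono ?_).congr ?_
  · rintro w hw
    simp only [mfld_simps] at hw
    exact (rep_mk_ne_zero_iff _ _ _).1 hw.2
  · intro w _
    ext i
    change (if i = k then w j * replaceOne j w k else
      (Projectivization.mk 𝕜 (replaceOne j w) (replaceOne_ne_zero j w)).rep i /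
        (Projectivization.mk 𝕜 (replaceOne j w) (replaceOne_ne_zero j w)).rep k) = _
    rw [rep_mk_div]

/-- The line `[v]` if `v ≠ 0`; the given default line `l` if `v = 0`. -/
def lineThrough (v : EuclideanSpace 𝕜 (Fin m)) (l : ℙ 𝕜 (EuclideanSpace 𝕜 (Fin m))) :
    ℙ 𝕜 (EuclideanSpace 𝕜 (Fin m)) :=
  open Classical in if hv : v = 0 then l else mk 𝕜 v hv

theorem lineThrough_mem (v : EuclideanSpace 𝕜 (Fin m)) (l : ℙ 𝕜 (EuclideanSpace 𝕜 (Fin m)))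
    (j k : Fin m) : v j * (lineThrough v l).rep k = v k * (lineThrough v l).rep j := by
  by_cases hv : v = 0
  · simp [hv]
  · simp only [lineThrough, hv, dite_false]
    exact (mem_iff v v hv).2 (fun j k => mul_comm _ _) j k

/-- The lift `ĥ : X → X` of a map `h` of `𝕜ᵐ` with `h 0 = 0`:
`ĥ (x, [x]) = (h x, [h x])` for `x ≠ 0`, and `ĥ (0, [y]) = (0, [Dh|₀ y])`.
The default values of `lineThrough` only matter if `h x = 0` for some `x ≠ 0`, or if `Dh|₀` is not
injective. -/
def lift (h : EuclideanSpace 𝕜 (Fin m) → EuclideanSpace 𝕜 (Fin m)) (z : BlowupModel 𝕜 m) :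
    BlowupModel 𝕜 m :=
  open Classical in
  if z.blowdown = 0 then
    ⟨(0, lineThrough (fderiv 𝕜 h 0 z.line.rep) z.line), fun j k => by simp⟩
  else
    ⟨(h z.blowdown, lineThrough (h z.blowdown) z.line), lineThrough_mem _ _⟩

end

end BlowupModel

/-! ### Lifted charts -/

/-- `Φ` is a lift of the chart `φ` of `M` along `q : V → M`: a `C^∞` isomorphism (holomorphic if
`𝕜 = ℂ`) from `q ⁻¹' φ.source` onto the part of the model `X` lying over `φ.target`, which covers
`φ`. -/
structure IsChartLift {𝕜 : Type*} [RCLike 𝕜] {m : ℕ} {V M : Type*}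
    [TopologicalSpace V] [ChartedSpace (EuclideanSpace 𝕜 (Fin m)) V] [TopologicalSpace M]
    (q : V → M) (φ : OpenPartialHomeomorph M (EuclideanSpace 𝕜 (Fin m)))
    (Φ : OpenPartialHomeomorph V (BlowupModel 𝕜 m)) : Prop where
  source_eq : Φ.source = q ⁻¹' φ.source
  target_eq : Φ.target = BlowupModel.blowdown ⁻¹' φ.target
  contMDiffOn_toFun : ContMDiffOn 𝓘(𝕜, EuclideanSpace 𝕜 (Fin m))
    𝓘(𝕜, EuclideanSpace 𝕜 (Fin m)) ∞ Φ Φ.source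
  contMDiffOn_symm : ContMDiffOn 𝓘(𝕜, EuclideanSpace 𝕜 (Fin m))
    𝓘(𝕜, EuclideanSpace 𝕜 (Fin m)) ∞ Φ.symm Φ.target
  blowdown_comp : ∀ v ∈ Φ.source, (Φ v).blowdown = φ (q v)

end

/-! A point of the model has the form `(μ y, [y])` with `y ≠ 0`, and the map `(μ, y) ↦ (μ y, [y])`
is smooth even at `μ = 0` (`contMDiffAt_point`). Hadamard's lemma
(`exists_contDiffOn_eq_apply_self`) writes a map `h` with `h 0 = 0` as `h x = A x x`, where `A x =
∫₀¹ Dh(s x) ds` is smooth and `A 0 = Dh|₀`. Hence `h (μ y) = μ A(μ y) y`, and near the exceptional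
locus the lift is `(μ y, [y]) ↦ (μ A(μ y) y, [A(μ y) y])`. This single formula covers both cases in
the definition of the lift, so lifts of coordinate changes are smooth (`contMDiffAt_lift`). The
chain rule makes them functorial along the exceptional locus. All of this is done over `𝕜`, so that
for `𝕜 = ℂ` smooth means holomorphic.

A single chart `φ₀` centred at `p` suffices to build the manifold: `M ∖ {p}` is glued to the part of
the model over `φ₀.target` (`exists_isGluedBlowup`). The overlap omits the exceptional locus, so
Hadamard's lemma plays no role there. It enters for another centred chart `φ`, whose lift is the
lift of `φ ∘ φ₀⁻¹` over `p` and `v ↦ (φ (q v), [φ (q v)])` elsewhere. Functoriality then gives the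
rule for coordinate changes (`liftedChart_liftedChartSymm`).

The topological claims come from projective space. It is Hausdorff, which separates points over `p`.
It is compact, so an open set around the exceptional locus contains a whole tube
(`eventually_forall_mem_of_isOpen`), and the blowdown is a quotient map. -/

noncomputable section

/-! ### Hadamard's lemma -/

section Hadamard
open MeasureTheory

variable {𝕜 : Type v} [RCLike 𝕜] {E : Type v} [NormedAddCommGroup E] [NormedSpace 𝕜 E]

theorem smul_mem_ball_zero {r : ℝ} {x : E} (hx : x ∈ Metric.ball (0 : E) r) {a : 𝕜} (ha : ‖a‖ ≤ 1) :
    a • x ∈ Metric.ball (0 : E) r := by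
  rw [mem_ball_zero_iff] at hx ⊢
  rw [norm_smul]
  nlinarith [norm_nonneg x, norm_nonneg a]

/-- The ball is stable under scalars of norm at most 1, so `f` is only evaluated where it is
continuous. Joint continuity in both variables supplies measurability, integrability and compactness
bounds for the integrals below. -/
theorem continuousOn_smul_comp_smul {F : Type*} [NormedAddCommGroup F] [NormedSpace 𝕜 F] {r : ℝ}
    {f : E → F} (hf : ContinuousOn f (Metric.ball 0 r)) {θ c : ℝ → 𝕜} (hθ : Continuous θ)
    (hθ1 : ∀ s, ‖θ s‖ ≤ 1) (hc : Continuous c) :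
    ContinuousOn (fun z : E × ℝ => c z.2 • f (θ z.2 • z.1)) (Metric.ball 0 r ×ˢ univ) := by
  refine (hc.comp continuous_snd).continuousOn.smul (hf.comp ?_ ?_)
  · exact ((hθ.comp continuous_snd).smul continuous_fst).continuousOn
  · rintro ⟨x, s⟩ hx
    exact smul_mem_ball_zero hx.1 (hθ1 s)

/-- Smooth dependence on `x` of the integral of `c s • f (θ s • x)` over `s ∈ [0, 1]`. -/
theorem contDiffOn_integral_smul_comp_smul [ProperSpace E] {r : ℝ} {θ : ℝ → 𝕜}
    (hθ : Continuous θ) (hθ1 : ∀ s, ‖θ s‖ ≤ 1) (n : ℕ) :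
    ∀ {F : Type v} [NormedAddCommGroup F] [NormedSpace 𝕜 F] [NormedSpace ℝ F]
      [IsScalarTower ℝ 𝕜 F] {f : E → F} {c : ℝ → 𝕜},
      ContDiffOn 𝕜 n f (Metric.ball 0 r) → Continuous c →
      ContDiffOn 𝕜 n (fun x => ∫ s in (0 : ℝ)..1, c s • f (θ s • x)) (Metric.ball 0 r) := by
  -- The induction runs over all `F`, `f` and `c` at once: the derivative is an integral of the same
  -- shape, with values in `E →L[𝕜] F` and weight `c * θ`. Taking `E` and `F` in one universe keeps
  -- `E →L[𝕜] F` in it.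
  induction n with
  | zero =>
    intro F _ _ _ _ f c hf hc
    simp only [Nat.cast_zero, contDiffOn_zero] at hf ⊢
    rw [continuousOn_iff_continuous_domRestrict]
    refine intervalIntegral.continuous_parametric_intervalIntegral_of_continuous'
      (f := fun (x : Metric.ball (0 : E) r) s => c s • f (θ s • (x : E))) ?_ 0 1
    exact (continuousOn_smul_comp_smul hf hθ hθ1 hc).comp_continuous
      (f := fun z : Metric.ball (0 : E) r × ℝ => ((z.1 : E), z.2)) (by fun_prop)
      fun z => ⟨z.1.2, mem_univ _⟩
  | succ n ih =>
    intro F _ _ _ _ f c hf hc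
    have hopen : IsOpen (Metric.ball (0 : E) r) := Metric.isOpen_ball
    push_cast at hf
    have hf' := (contDiffOn_succ_iff_fderiv_of_isOpen hopen).1 hf
    have hcf : ContinuousOn f (Metric.ball 0 r) := hf.continuousOn
    have hcf' : ContinuousOn (fderiv 𝕜 f) (Metric.ball 0 r) := hf'.2.2.continuousOn
    have hder : ∀ x ∈ Metric.ball (0 : E) r,
        HasFDerivAt (fun x => ∫ s in (0 : ℝ)..1, c s • f (θ s • x))
          (∫ s in (0 : ℝ)..1, (c s * θ s) • fderiv 𝕜 f (θ s • x)) x := by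
      intro x₀ hx₀
      obtain ⟨ε, hε, hsub⟩ := Metric.nhds_basis_closedBall.mem_iff.1 (hopen.mem_nhds hx₀)
      have hcont := continuousOn_smul_comp_smul hcf hθ hθ1 hc
      have hcont' := continuousOn_smul_comp_smul hcf' hθ hθ1 (hc.mul hθ)
      have hs (x) (hx : x ∈ Metric.ball (0 : E) r) : Continuous fun s => c s • f (θ s • x) :=
        hcont.comp_continuous (f := fun s => (x, s)) (by fun_prop) fun s => ⟨hx, mem_univ _⟩
      have hs' : Continuous fun s => (c s * θ s) • fderiv 𝕜 f (θ s • x₀) :=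
        hcont'.comp_continuous (f := fun s => (x₀, s)) (by fun_prop) fun s => ⟨hx₀, mem_univ _⟩
      -- Properness of `E` makes the closed ball compact, so a constant dominates the derivative of
      -- the integrand and differentiation under the integral is allowed.
      obtain ⟨C, hC⟩ := ((isCompact_closedBall x₀ ε).prod (isCompact_Icc (a := (0 : ℝ))
        (b := 1))).exists_bound_of_continuousOn (hcont'.mono (prod_mono hsub (subset_univ _)))
      refine intervalIntegral.hasFDerivAt_integral_of_dominated_of_fderiv_le
        (s := Metric.closedBall x₀ ε) (bound := fun _ => C)
        (F' := fun x s => (c s * θ s) • fderiv 𝕜 f (θ s • x))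
        (Metric.closedBall_mem_nhds _ hε) ?_ ?_ ?_ ?_ ?_ ?_
      · filter_upwards [hopen.mem_nhds hx₀] with x hx
        exact (hs x hx).aestronglyMeasurable
      · exact (hs x₀ hx₀).intervalIntegrable _ _
      · exact hs'.aestronglyMeasurable
      · refine Filter.Eventually.of_forall fun s hs x hx => hC (x, s) ⟨hx, ?_⟩
        rw [uIoc_of_le zero_le_one] at hs
        exact ⟨hs.1.le, hs.2⟩
      · simp
      · refine Filter.Eventually.of_forall fun s hs x hx => ?_
        have h1 : HasFDerivAt f (fderiv 𝕜 f (θ s • x)) (θ s • x) :=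
          (hf'.1.differentiableAt
            (hopen.mem_nhds (smul_mem_ball_zero (hsub hx) (hθ1 s)))).hasFDerivAt
        have h2 : HasFDerivAt (fun x : E => θ s • x) (θ s • ContinuousLinearMap.id 𝕜 E) x :=
          (hasFDerivAt_id x).const_smul (θ s)
        have h3 := (h1.comp x h2).const_smul (c s)
        refine h3.congr_fderiv ?_
        ext w
        simp [mul_smul]
    push_cast
    rw [contDiffOn_succ_iff_fderiv_of_isOpen hopen]
    refine ⟨fun x hx => (hder x hx).differentiableAt.differentiableWithinAt, by simp, ?_⟩
    exact (ih hf'.2.2 (hc.mul hθ)).congr fun x hx => (hder x hx).fderiv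

/-- Hadamard's lemma: a smooth map `h` with `h 0 = 0` is of the form `h x = A x x` near `0`, with
`A` smooth. -/
theorem exists_contDiffOn_eq_apply_self [ProperSpace E] {F : Type v} [NormedAddCommGroup F]
    [NormedSpace 𝕜 F] [NormedSpace ℝ F] [IsScalarTower ℝ 𝕜 F] [CompleteSpace F] {r : ℝ}
    {h : E → F} (hh : ContDiffOn 𝕜 ∞ h (Metric.ball 0 r)) (h0 : h 0 = 0) :
    ∃ A : E → E →L[𝕜] F, ContDiffOn 𝕜 ∞ A (Metric.ball 0 r) ∧ A 0 = fderiv 𝕜 h 0 ∧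
      ∀ x ∈ Metric.ball (0 : E) r, h x = A x x := by
  have hopen : IsOpen (Metric.ball (0 : E) r) := Metric.isOpen_ball
  -- Clamping `s` to `[0, 1]` bounds `θ` by 1 on all of `ℝ` without changing the integral over `[0,
  -- 1]`.
  let θ : ℝ → 𝕜 := fun s => ((projIcc (0 : ℝ) 1 zero_le_one s : ℝ) : 𝕜)
  have hθ : Continuous θ :=
    RCLike.continuous_ofReal.comp (continuous_subtype_val.comp continuous_projIcc)
  have hθ1 (s) : ‖θ s‖ ≤ 1 := by
    have := (projIcc (0 : ℝ) 1 zero_le_one s).2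
    simp only [θ, RCLike.norm_ofReal, abs_of_nonneg this.1]
    exact this.2
  have hθs (s) (hs : s ∈ Icc (0 : ℝ) 1) : θ s = s := by simp [θ, projIcc_of_mem _ hs]
  have hd : ContDiffOn 𝕜 ∞ (fderiv 𝕜 h) (Metric.ball 0 r) := by
    have : ContDiffOn 𝕜 (∞ + 1) h (Metric.ball 0 r) := by simpa using hh
    exact ((contDiffOn_succ_iff_fderiv_of_isOpen hopen).1 this).2.2
  -- The factor `1` is the weight `c` of the parametric integral.
  refine ⟨fun x => ∫ s in (0 : ℝ)..1, (1 : 𝕜) • fderiv 𝕜 h (θ s • x), ?_, by simp, ?_⟩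
  · rw [contDiffOn_infty]
    exact fun n => contDiffOn_integral_smul_comp_smul hθ hθ1 n
      (hd.of_le (by exact_mod_cast le_top)) continuous_const
  · intro x hx
    have hcont : Continuous fun s => fderiv 𝕜 h (θ s • x) := by
      have := (continuousOn_smul_comp_smul hd.continuousOn hθ hθ1
        (continuous_const (y := (1 : 𝕜)))).comp_continuous (f := fun s => (x, s)) (by fun_prop)
        fun s => ⟨hx, mem_univ _⟩
      simpa [Function.comp_def] using this
    simp only [one_smul]
    rw [ContinuousLinearMap.intervalIntegral_apply (hcont.intervalIntegrable _ _)]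
    -- The fundamental theorem of calculus along the real segment `s ↦ h (s x)`.
    have := intervalIntegral.integral_eq_sub_of_hasDerivAt (a := 0) (b := 1)
      (f := fun s : ℝ => h ((s : 𝕜) • x)) (f' := fun s => fderiv 𝕜 h (θ s • x) x) ?_ ?_
    · simpa [h0] using this.symm
    · intro s hs
      rw [uIcc_of_le zero_le_one] at hs
      rw [hθs s hs]
      have h1 : HasFDerivAt h (fderiv 𝕜 h ((s : 𝕜) • x)) ((s : 𝕜) • x) := by
        refine ((hh.differentiableOn (by simp)).differentiableAt (hopen.mem_nhds ?_)).hasFDerivAt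
        exact smul_mem_ball_zero hx (hθs s hs ▸ hθ1 s)
      have h2 : HasDerivAt (fun t : 𝕜 => t • x) x (s : 𝕜) := by
        simpa using (hasDerivAt_id (s : 𝕜)).smul_const x
      have h3 : HasDerivAt (fun s : ℝ => (s : 𝕜)) 1 s := by
        simpa using (RCLike.ofRealCLM (K := 𝕜)).hasDerivAt (x := s)
      simpa [Function.comp_def] using (h1.comp_hasDerivAt (s : 𝕜) h2).scomp s h3
    · exact (hcont.clm_apply continuous_const).intervalIntegrable _ _

end Hadamard

/-! ### Topology of projective space -/

namespace Projectivization

variable {𝕜 : Type*} [RCLike 𝕜] {m n : ℕ}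

/-- The entry `yᵢ ȳₖ / |y|²` of the matrix of the orthogonal projection onto the line `[y]`. -/
def projEntry (i k : Fin m) (l : ℙ 𝕜 (EuclideanSpace 𝕜 (Fin m))) : 𝕜 :=
  l.rep i * starRingEnd 𝕜 (l.rep k) / ((‖l.rep‖ ^ 2 : ℝ) : 𝕜)

/-- Rescaling the representative by `a` multiplies numerator and denominator by `a ā = |a|²`.
Continuity on the quotient can thus be checked on nonzero vectors. -/
theorem projEntry_mk (i k : Fin m) (y : EuclideanSpace 𝕜 (Fin m)) (hy : y ≠ 0) :
    projEntry i k (mk 𝕜 y hy) = y i * starRingEnd 𝕜 (y k) / ((‖y‖ ^ 2 : ℝ) : 𝕜) := by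
  obtain ⟨a, ha⟩ := exists_smul_eq_mk_rep 𝕜 y hy
  have hy' : (‖y‖ : 𝕜) ≠ 0 := by simpa using hy
  have ha' : ((‖(a : 𝕜)‖ : ℝ) : 𝕜) ≠ 0 := by simp
  have key : (a : 𝕜) * starRingEnd 𝕜 a = ((‖(a : 𝕜)‖ : ℝ) : 𝕜) ^ 2 := RCLike.mul_conj _
  rw [projEntry, ← ha, Units.smul_def, norm_smul]
  simp only [PiLp.smul_apply, smul_eq_mul, map_mul, mul_pow]
  push_cast
  rw [div_eq_div_iff (by positivity) (by positivity), ← key]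
  ring

theorem continuous_projEntry (i k : Fin m) :
    Continuous (projEntry i k : ℙ 𝕜 (EuclideanSpace 𝕜 (Fin m)) → 𝕜) := by
  rw [(isQuotientMap_mk' 𝕜 _).continuous_iff]
  have : Continuous fun y : {y : EuclideanSpace 𝕜 (Fin m) // y ≠ 0} =>
      y.1 i * starRingEnd 𝕜 (y.1 k) / ((‖y.1‖ ^ 2 : ℝ) : 𝕜) := by
    refine Continuous.div ?_ ?_ fun y => ?_
    · exact Continuous.mul (by fun_prop) (RCLike.continuous_conj.comp (by fun_prop))
    · exact RCLike.continuous_ofReal.comp (by fun_prop)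
    · simpa using y.2
  exact this.congr fun y => (projEntry_mk i k y.1 y.2).symm

/-- A line is recovered from its orthogonal projection, since any nonzero column of the matrix spans
it. The matrix entries therefore give a continuous injection into a Hausdorff space. -/
instance instT2Space : T2Space (ℙ 𝕜 (EuclideanSpace 𝕜 (Fin m))) := by
  refine T2Space.of_injective_continuous
    (f := fun l (z : Fin m × Fin m) => projEntry z.1 z.2 l) ?_
    (continuous_pi fun z => continuous_projEntry _ _)
  intro l l' h
  obtain ⟨k, hk⟩ := exists_rep_ne_zero l
  have h' (i) : projEntry i k l = projEntry i k l' := congrFun h (i, k)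
  rw [← l.mk_rep, ← l'.mk_rep, mk_eq_mk_iff']
  have hn : ((‖l.rep‖ ^ 2 : ℝ) : 𝕜) ≠ 0 := by simpa using l.rep_nonzero
  have hk' : starRingEnd 𝕜 (l.rep k) ≠ 0 := by simpa using hk
  -- The scalar is found by equating the `k`-th columns of the two matrices and solving for `l.rep
  -- i`.
  refine ⟨starRingEnd 𝕜 (l'.rep k) / ((‖l'.rep‖ ^ 2 : ℝ) : 𝕜) * ((‖l.rep‖ ^ 2 : ℝ) : 𝕜) /
    starRingEnd 𝕜 (l.rep k), ?_⟩
  ext i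
  have := h' i
  simp only [projEntry] at this
  rw [div_eq_iff hn] at this
  simp only [PiLp.smul_apply, smul_eq_mul]
  rw [div_mul_eq_mul_div, div_eq_iff hk', this]
  ring

/-- Projective space is the continuous image of the unit sphere. -/
instance instCompactSpace : CompactSpace (ℙ 𝕜 (EuclideanSpace 𝕜 (Fin m))) := by
  have hc : CompactSpace (Metric.sphere (0 : EuclideanSpace 𝕜 (Fin m)) 1) :=
    isCompact_iff_compactSpace.1 (isCompact_sphere _ _)
  have h0 (y : Metric.sphere (0 : EuclideanSpace 𝕜 (Fin m)) 1) :
      (y : EuclideanSpace 𝕜 (Fin m)) ≠ 0 := Metric.ne_of_mem_sphere y.2 one_ne_zero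
  have hcont : Continuous fun y : Metric.sphere (0 : EuclideanSpace 𝕜 (Fin m)) 1 =>
      mk 𝕜 (y : EuclideanSpace 𝕜 (Fin m)) (h0 y) :=
    (isQuotientMap_mk' 𝕜 _).continuous.comp (continuous_subtype_val.subtype_mk h0)
  suffices hs : Function.Surjective fun y : Metric.sphere (0 : EuclideanSpace 𝕜 (Fin m)) 1 =>
      mk 𝕜 (y : EuclideanSpace 𝕜 (Fin m)) (h0 y) from
    ⟨hs.range_eq ▸ isCompact_range hcont⟩
  intro l
  have hl : ((‖l.rep‖ : ℝ) : 𝕜) ≠ 0 := by simpa using l.rep_nonzero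
  refine ⟨⟨((‖l.rep‖ : ℝ) : 𝕜)⁻¹ • l.rep, ?_⟩, ?_⟩
  · rw [mem_sphere_zero_iff_norm, norm_smul, norm_inv, RCLike.norm_ofReal, abs_norm]
    exact inv_mul_cancel₀ (by simpa using l.rep_nonzero)
  · conv_rhs => rw [← l.mk_rep]
    rw [mk_eq_mk_iff']
    exact ⟨_, rfl⟩

/-- The affine pieces are images of vector spaces, hence connected, and all contain `[1, …, 1]`. -/
instance instConnectedSpace : ConnectedSpace (ℙ 𝕜 (EuclideanSpace 𝕜 (Fin (n + 1)))) := by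
  let e : EuclideanSpace 𝕜 (Fin (n + 1)) := WithLp.toLp 2 fun _ => 1
  have he : e ≠ 0 := fun h => by simpa [e] using congrArg (fun v => v.ofLp 0) h
  have hcover : ⋃ j, range (affineChart 𝕜 n j).symm = univ := by
    refine eq_univ_of_forall fun l => mem_iUnion.2 ?_
    obtain ⟨j, hj⟩ := exists_rep_ne_zero l
    exact ⟨j, _, (affineChart 𝕜 n j).left_inv hj⟩
  have hpre : IsPreconnected (⋃ j, range (affineChart 𝕜 n j).symm) := by
    refine isPreconnected_iUnion ⟨mk 𝕜 e he, mem_iInter.2 fun j =>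
      ⟨affineChart 𝕜 n j (mk 𝕜 e he), (affineChart 𝕜 n j).left_inv ?_⟩⟩ fun j => ?_
    · exact (rep_mk_ne_zero_iff e he j).2 (by simp [e])
    · exact isPreconnected_range (continuous_affineInv j)
  rw [hcover] at hpre
  exact { isPreconnected_univ := hpre, toNonempty := ⟨mk 𝕜 e he⟩ }

end Projectivization

/-! ### The model blowup -/

namespace BlowupModel

open Projectivization

variable {𝕜 : Type*} [RCLike 𝕜] {m n : ℕ}

theorem ext {z z' : BlowupModel 𝕜 m} (h : z.blowdown = z'.blowdown) (h' : z.line = z'.line) :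
    z = z' :=
  Subtype.ext (Prod.ext h h')

instance : T2Space (BlowupModel 𝕜 m) := inferInstanceAs (T2Space (Subtype _))

theorem lineThrough_of_ne_zero {v : EuclideanSpace 𝕜 (Fin m)} (hv : v ≠ 0)
    (l : ℙ 𝕜 (EuclideanSpace 𝕜 (Fin m))) : lineThrough v l = mk 𝕜 v hv := dif_neg hv

theorem lineThrough_smul {v : EuclideanSpace 𝕜 (Fin m)} {a : 𝕜} (ha : a ≠ 0) (hv : v ≠ 0)
    (l l' : ℙ 𝕜 (EuclideanSpace 𝕜 (Fin m))) : lineThrough (a • v) l = lineThrough v l' := by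
  rw [lineThrough_of_ne_zero hv, lineThrough_of_ne_zero (smul_ne_zero ha hv), mk_eq_mk_iff']
  exact ⟨a, rfl⟩

theorem lineThrough_rep (l l' : ℙ 𝕜 (EuclideanSpace 𝕜 (Fin m))) : lineThrough l.rep l' = l := by
  rw [lineThrough_of_ne_zero l.rep_nonzero, mk_rep]

theorem exists_smul_eq_rep_lineThrough {v : EuclideanSpace 𝕜 (Fin m)} (hv : v ≠ 0)
    (l : ℙ 𝕜 (EuclideanSpace 𝕜 (Fin m))) : ∃ a : 𝕜, a ≠ 0 ∧ (lineThrough v l).rep = a • v := by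
  rw [lineThrough_of_ne_zero hv]
  obtain ⟨a, ha⟩ := exists_smul_eq_mk_rep 𝕜 v hv
  exact ⟨a, a.ne_zero, ha.symm⟩

/-- The point `(μ y, [y])` of `X`, with a default line in place of `[y]` if `y = 0`. -/
def point (l : ℙ 𝕜 (EuclideanSpace 𝕜 (Fin m))) (μ : 𝕜) (y : EuclideanSpace 𝕜 (Fin m)) :
    BlowupModel 𝕜 m :=
  ⟨(μ • y, lineThrough y l), fun j k => by
    simp only [PiLp.smul_apply, smul_eq_mul, mul_assoc, lineThrough_mem y l j k]⟩

@[simp] theorem blowdown_point (l : ℙ 𝕜 (EuclideanSpace 𝕜 (Fin m))) (μ : 𝕜)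
    (y : EuclideanSpace 𝕜 (Fin m)) : (point l μ y).blowdown = μ • y := rfl

@[simp] theorem line_point (l : ℙ 𝕜 (EuclideanSpace 𝕜 (Fin m))) (μ : 𝕜)
    (y : EuclideanSpace 𝕜 (Fin m)) : (point l μ y).line = lineThrough y l := rfl

theorem point_eq_ofSMul (l : ℙ 𝕜 (EuclideanSpace 𝕜 (Fin m))) (μ : 𝕜)
    {y : EuclideanSpace 𝕜 (Fin m)} (hy : y ≠ 0) : point l μ y = ofSMul μ y hy :=
  ext rfl (lineThrough_of_ne_zero hy l)

theorem point_eq_chart_symm (l : ℙ 𝕜 (EuclideanSpace 𝕜 (Fin m))) (μ : 𝕜)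
    (y : EuclideanSpace 𝕜 (Fin m)) {k : Fin m} (hk : y k ≠ 0) :
    point l μ y =
      (chart 𝕜 m k).symm (WithLp.toLp 2 fun i => if i = k then μ * y k else y i / y k) := by
  have hy : y ≠ 0 := fun h => hk (by simp [h])
  rw [point_eq_ofSMul l μ hy]
  have hs : ofSMul μ y hy ∈ (chart 𝕜 m k).source := (rep_mk_ne_zero_iff y hy k).2 hk
  rw [← (chart 𝕜 m k).left_inv hs]
  congr 1
  ext i
  change (if i = k then (μ • y) k else (mk 𝕜 y hy).rep i / (mk 𝕜 y hy).rep k) = _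
  simp [rep_mk_div]

theorem eq_point (l : ℙ 𝕜 (EuclideanSpace 𝕜 (Fin m))) {j : Fin m} {z : BlowupModel 𝕜 m}
    (hz : z ∈ (chart 𝕜 m j).source) :
    z = point l (chart 𝕜 m j z j) (replaceOne j (chart 𝕜 m j z)) := by
  rw [point_eq_ofSMul l _ (replaceOne_ne_zero _ _)]
  exact ((chart 𝕜 m j).left_inv hz).symm

/-- If `x = μ y ≠ 0` then `μ ≠ 0`, so `[y] = [x]`: off the exceptional locus a point is determined
by its blowdown. -/
theorem line_eq_lineThrough {z : BlowupModel 𝕜 m} (hz : z.blowdown ≠ 0)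
    (l : ℙ 𝕜 (EuclideanSpace 𝕜 (Fin m))) : z.line = lineThrough z.blowdown l := by
  obtain ⟨j, hj⟩ := exists_rep_ne_zero z.line
  have h := eq_point l (j := j) (z := z) hj
  have h0 : chart 𝕜 m j z j ≠ 0 := fun h0 => hz (by rw [h, h0]; simp)
  rw [h, blowdown_point, line_point]
  exact (lineThrough_smul h0 (replaceOne_ne_zero _ _) _ _).symm

theorem eq_point_blowdown (l : ℙ 𝕜 (EuclideanSpace 𝕜 (Fin m))) {z : BlowupModel 𝕜 m}
    (hz : z.blowdown ≠ 0) : z = point l 1 z.blowdown :=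
  ext (by simp) (line_eq_lineThrough hz l)

/-! ### Smooth maps to and from the model -/

theorem chart_mem_maximalAtlas (j : Fin m) :
    chart 𝕜 m j ∈ IsManifold.maximalAtlas 𝓘(𝕜, EuclideanSpace 𝕜 (Fin m)) ∞
      (BlowupModel 𝕜 m) :=
  IsManifold.subset_maximalAtlas (mem_range_self j)

/-- In the chart of a coordinate with `y k ≠ 0` the map reads `(μ yₖ, yᵢ / yₖ)`, which is regular at
`μ = 0` too. Smoothness of maps into the model thereby reduces to smoothness of a scalar and a
nonvanishing vector. -/
theorem contMDiffAt_point (l : ℙ 𝕜 (EuclideanSpace 𝕜 (Fin m))) (μ : 𝕜)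
    {y : EuclideanSpace 𝕜 (Fin m)} (hy : y ≠ 0) :
    ContMDiffAt 𝓘(𝕜, 𝕜 × EuclideanSpace 𝕜 (Fin m)) 𝓘(𝕜, EuclideanSpace 𝕜 (Fin m)) ∞
      (fun w : 𝕜 × EuclideanSpace 𝕜 (Fin m) => point l w.1 w.2) (μ, y) := by
  obtain ⟨k, hk⟩ : ∃ k, y k ≠ 0 := by
    by_contra! h
    exact hy (by ext i; simpa using h i)
  have hc (i : Fin m) : ContDiff 𝕜 ∞ fun w : 𝕜 × EuclideanSpace 𝕜 (Fin m) => w.2 i :=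
    (contDiff_euclidean.1 contDiff_id i).comp contDiff_snd
  have hg : ContDiffAt 𝕜 ∞ (fun w : 𝕜 × EuclideanSpace 𝕜 (Fin m) =>
      WithLp.toLp 2 fun i => if i = k then w.1 * w.2 k else w.2 i / w.2 k) (μ, y) := by
    rw [contDiffAt_euclidean]
    intro i
    by_cases hi : i = k
    · simpa only [hi, if_true] using (contDiff_fst.mul (hc k)).contDiffAt
    · simp only [hi, if_false]
      exact (hc i).contDiffAt.div (hc k).contDiffAt hk
  refine ((contMDiffAt_symm_of_mem_maximalAtlas (chart_mem_maximalAtlas k) (mem_univ _)).comp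
    (μ, y) hg.contMDiffAt).congr_of_eventuallyEq ?_
  filter_upwards [(hc k).continuous.continuousAt.eventually_ne hk] with w hw
  exact point_eq_chart_symm l _ _ hw

theorem contMDiffAt_point_one (l : ℙ 𝕜 (EuclideanSpace 𝕜 (Fin m)))
    {y : EuclideanSpace 𝕜 (Fin m)} (hy : y ≠ 0) :
    ContMDiffAt 𝓘(𝕜, EuclideanSpace 𝕜 (Fin m)) 𝓘(𝕜, EuclideanSpace 𝕜 (Fin m)) ∞
      (point l 1) y :=
  (contMDiffAt_point l 1 hy).comp y (contDiff_prodMk_right (1 : 𝕜)).contMDiff.contMDiffAt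

theorem contMDiff_blowdown :
    ContMDiff 𝓘(𝕜, EuclideanSpace 𝕜 (Fin m)) 𝓘(𝕜, EuclideanSpace 𝕜 (Fin m)) ∞
      (blowdown : BlowupModel 𝕜 m → _) := by
  intro z
  obtain ⟨j, hj⟩ := exists_rep_ne_zero z.line
  have hg : ContDiff 𝕜 ∞ fun w : EuclideanSpace 𝕜 (Fin m) => w j • replaceOne j w :=
    ContDiff.smul (f := fun w : EuclideanSpace 𝕜 (Fin m) => w j)
      (contDiff_euclidean.1 contDiff_id j) (contDiff_replaceOne j ∞)
  refine (hg.contMDiff.contMDiffAt.comp z (contMDiffAt_of_mem_maximalAtlas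
    (chart_mem_maximalAtlas j) hj)).congr_of_eventuallyEq ?_
  filter_upwards [(chart 𝕜 m j).open_source.mem_nhds hj] with z' hz'
  conv_lhs => rw [eq_point z.line hz']
  rfl

/-! ### Lifts of maps to the model -/

theorem lift_of_blowdown_eq_zero (h : EuclideanSpace 𝕜 (Fin m) → EuclideanSpace 𝕜 (Fin m))
    {z : BlowupModel 𝕜 m} (hz : z.blowdown = 0) :
    lift h z = point (lineThrough (fderiv 𝕜 h 0 z.line.rep) z.line) 0 0 := by
  refine Eq.trans (if_pos hz) (ext ?_ ?_)
  · exact (smul_zero (0 : 𝕜)).symm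
  · exact ((line_point _ _ _).trans (dif_pos rfl)).symm

theorem lift_of_blowdown_ne_zero (h : EuclideanSpace 𝕜 (Fin m) → EuclideanSpace 𝕜 (Fin m))
    {z : BlowupModel 𝕜 m} (hz : z.blowdown ≠ 0) : lift h z = point z.line 1 (h z.blowdown) := by
  exact Eq.trans (if_neg hz) (ext (one_smul 𝕜 _).symm rfl)

theorem point_congr_line {v : EuclideanSpace 𝕜 (Fin m)} (hv : v ≠ 0)
    (l l' : ℙ 𝕜 (EuclideanSpace 𝕜 (Fin m))) (μ : 𝕜) : point l μ v = point l' μ v := by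
  rw [point_eq_ofSMul l μ hv, point_eq_ofSMul l' μ hv]

theorem blowdown_lift_of_eq_zero (h : EuclideanSpace 𝕜 (Fin m) → EuclideanSpace 𝕜 (Fin m))
    {z : BlowupModel 𝕜 m} (hz : z.blowdown = 0) : (lift h z).blowdown = 0 := by
  simp [lift_of_blowdown_eq_zero h hz]

theorem line_lift_of_eq_zero (h : EuclideanSpace 𝕜 (Fin m) → EuclideanSpace 𝕜 (Fin m))
    {z : BlowupModel 𝕜 m} (hz : z.blowdown = 0) :
    (lift h z).line = lineThrough (fderiv 𝕜 h 0 z.line.rep) z.line := by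
  rw [lift_of_blowdown_eq_zero h hz]
  simp [lineThrough]

/-- This merges the two cases in the definition of the lift: for `μ ≠ 0` the factor `μ` disappears
in projective space, and for `μ = 0` the derivative supplies the direction. It is applied with `v =
A(μ y) y` from Hadamard's lemma. -/
theorem lift_point {h : EuclideanSpace 𝕜 (Fin m) → EuclideanSpace 𝕜 (Fin m)}
    (l : ℙ 𝕜 (EuclideanSpace 𝕜 (Fin m))) {μ : 𝕜} {y v : EuclideanSpace 𝕜 (Fin m)} (hy : y ≠ 0)
    (hv : v ≠ 0) (h1 : h (μ • y) = μ • v) (h2 : μ = 0 → fderiv 𝕜 h 0 y = v) :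
    lift h (point l μ y) = point l μ v := by
  by_cases hμ : μ = 0
  · subst hμ
    refine ext (by simpa using blowdown_lift_of_eq_zero h (z := point l 0 y) (by simp)) ?_
    rw [line_lift_of_eq_zero h (by simp), line_point, line_point]
    obtain ⟨a, ha, hrep⟩ := exists_smul_eq_rep_lineThrough hy l
    rw [hrep, map_smul, h2 rfl]
    exact lineThrough_smul ha hv _ _
  · rw [lift_of_blowdown_ne_zero h (by simp [hμ, hy])]
    refine ext (by simp [h1]) ?_
    simp only [line_point, blowdown_point, h1]
    exact lineThrough_smul hμ hv _ _

/-- Functoriality of lifts along the exceptional locus. -/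
theorem lift_lift_of_blowdown_eq_zero
    {g h k : EuclideanSpace 𝕜 (Fin m) → EuclideanSpace 𝕜 (Fin m)}
    {z : BlowupModel 𝕜 m} (hz : z.blowdown = 0) (h0 : h 0 = 0) (hg : DifferentiableAt 𝕜 g 0)
    (hh : DifferentiableAt 𝕜 h 0) (hgi : Function.Injective (fderiv 𝕜 g 0))
    (hhi : Function.Injective (fderiv 𝕜 h 0)) (hk : k =ᶠ[𝓝 0] g ∘ h) :
    lift g (lift h z) = lift k z := by
  have hz' := blowdown_lift_of_eq_zero h hz
  refine ext (by rw [blowdown_lift_of_eq_zero _ hz', blowdown_lift_of_eq_zero _ hz]) ?_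
  have hv : fderiv 𝕜 h 0 z.line.rep ≠ 0 :=
    (map_ne_zero_iff _ hhi).2 z.line.rep_nonzero
  obtain ⟨a, ha, hrep⟩ := exists_smul_eq_rep_lineThrough hv z.line
  rw [line_lift_of_eq_zero _ hz', line_lift_of_eq_zero _ hz, line_lift_of_eq_zero _ hz, hrep,
    map_smul, hk.fderiv_eq, fderiv_comp _ (by rwa [h0]) hh, h0]
  exact lineThrough_smul ha ((map_ne_zero_iff _ hgi).2 hv) _ _

theorem lift_eq_self_of_blowdown_eq_zero
    {k : EuclideanSpace 𝕜 (Fin m) → EuclideanSpace 𝕜 (Fin m)}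
    {z : BlowupModel 𝕜 m} (hz : z.blowdown = 0) (hk : k =ᶠ[𝓝 0] id) : lift k z = z := by
  refine ext (by rw [blowdown_lift_of_eq_zero _ hz, hz]) ?_
  rw [line_lift_of_eq_zero _ hz, hk.fderiv_eq, fderiv_id]
  exact lineThrough_rep _ _

/-- The inclusion `l ↦ (0, l)` of the exceptional locus. -/
def zeroSection (l : ℙ 𝕜 (EuclideanSpace 𝕜 (Fin m))) : BlowupModel 𝕜 m := point l 0 0

@[simp] theorem blowdown_zeroSection (l : ℙ 𝕜 (EuclideanSpace 𝕜 (Fin m))) :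
    (zeroSection l).blowdown = 0 := by simp [zeroSection]

@[simp] theorem line_zeroSection (l : ℙ 𝕜 (EuclideanSpace 𝕜 (Fin m))) :
    (zeroSection l).line = l := by simp [zeroSection, lineThrough]

theorem zeroSection_line {z : BlowupModel 𝕜 m} (hz : z.blowdown = 0) : zeroSection z.line = z :=
  ext (by simp [hz]) (by simp)

theorem continuous_zeroSection :
    Continuous (zeroSection : ℙ 𝕜 (EuclideanSpace 𝕜 (Fin m)) → BlowupModel 𝕜 m) := by
  refine Continuous.subtype_mk (f := fun l : ℙ 𝕜 (EuclideanSpace 𝕜 (Fin m)) =>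
    ((0 : EuclideanSpace 𝕜 (Fin m)), l)) (by fun_prop) (fun l j k => by simp) |>.congr fun l => ?_
  exact ext (blowdown_zeroSection l).symm (line_zeroSection l).symm

instance : SecondCountableTopology (BlowupModel 𝕜 m) := by
  have h (j : Fin m) : SecondCountableTopology (chart 𝕜 m j).source :=
    (chart 𝕜 m j).secondCountableTopology_source
  refine TopologicalSpace.secondCountableTopology_of_countable_cover
    (U := fun j => (chart 𝕜 m j).source) (fun j => (chart 𝕜 m j).open_source) ?_
  exact eq_univ_of_forall fun z => mem_iUnion.2 (exists_rep_ne_zero z.line)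

/-- An open set containing the exceptional locus contains the part of `X` over a neighbourhood
of `0`. -/
theorem eventually_forall_mem_of_isOpen {W : Set (BlowupModel 𝕜 m)} (hW : IsOpen W)
    (h0 : ∀ z : BlowupModel 𝕜 m, z.blowdown = 0 → z ∈ W) :
    ∀ᶠ x in 𝓝 (0 : EuclideanSpace 𝕜 (Fin m)), ∀ z : BlowupModel 𝕜 m, z.blowdown = x → z ∈ W := by
  obtain ⟨W', hW', rfl⟩ := isOpen_induced_iff.1 hW
  -- Compactness of projective space yields a product neighbourhood `u × w` with `w` everything.
  obtain ⟨u, w, hu, -, h0u, hw, huw⟩ := generalized_tube_lemma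
    (isCompact_singleton (x := (0 : EuclideanSpace 𝕜 (Fin m))))
    (isCompact_univ (X := ℙ 𝕜 (EuclideanSpace 𝕜 (Fin m)))) hW' (by
      rintro ⟨x, l⟩ ⟨rfl, -⟩
      have : (zeroSection l).1 ∈ W' := h0 (zeroSection l) (by simp)
      rwa [show (zeroSection l).1 = (0, l) from
        Prod.ext (blowdown_zeroSection l) (line_zeroSection l)] at this)
  filter_upwards [hu.mem_nhds (h0u rfl)] with x hx z hz
  exact huw ⟨show z.blowdown ∈ u from hz ▸ hx, hw (mem_univ _)⟩

/-- The lift of a local diffeomorphism is smooth along the exceptional locus. -/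
theorem contMDiffAt_lift {r : ℝ} (hr : 0 < r)
    {h : EuclideanSpace 𝕜 (Fin m) → EuclideanSpace 𝕜 (Fin m)}
    (hh : ContDiffOn 𝕜 ∞ h (Metric.ball 0 r)) (h0 : h 0 = 0)
    (hi : Function.Injective (fderiv 𝕜 h 0)) {z : BlowupModel 𝕜 m} (hz : z.blowdown = 0) :
    ContMDiffAt 𝓘(𝕜, EuclideanSpace 𝕜 (Fin m)) 𝓘(𝕜, EuclideanSpace 𝕜 (Fin m)) ∞ (lift h) z := by
  obtain ⟨A, hA, hA0, hAh⟩ := exists_contDiffOn_eq_apply_self hh h0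
  obtain ⟨j, hj⟩ := exists_rep_ne_zero z.line
  have hball : Metric.ball (0 : EuclideanSpace 𝕜 (Fin m)) r ∈ 𝓝 z.blowdown :=
    hz ▸ Metric.ball_mem_nhds _ hr
  have hchart := contMDiffAt_of_mem_maximalAtlas (chart_mem_maximalAtlas (𝕜 := 𝕜) j) hj
  have hμ : ContMDiffAt 𝓘(𝕜, EuclideanSpace 𝕜 (Fin m)) 𝓘(𝕜, 𝕜) ∞
      (fun z' => chart 𝕜 m j z' j) z :=
    ContMDiffAt.comp (g := fun w : EuclideanSpace 𝕜 (Fin m) => w j) z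
      (contDiff_euclidean.1 contDiff_id j).contMDiff.contMDiffAt hchart
  have hy : ContMDiffAt 𝓘(𝕜, EuclideanSpace 𝕜 (Fin m)) 𝓘(𝕜, EuclideanSpace 𝕜 (Fin m)) ∞
      (fun z' => replaceOne j (chart 𝕜 m j z')) z :=
    ContMDiffAt.comp (g := replaceOne (𝕜 := 𝕜) j) z
      (contDiff_replaceOne j ∞).contMDiff.contMDiffAt hchart
  have hAz : ContMDiffAt 𝓘(𝕜, EuclideanSpace 𝕜 (Fin m)) 𝓘(𝕜, EuclideanSpace 𝕜 (Fin m) →L[𝕜]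
      EuclideanSpace 𝕜 (Fin m)) ∞ (fun z' => A z'.blowdown) z :=
    ContMDiffAt.comp z (hA.contDiffAt hball).contMDiffAt contMDiff_blowdown.contMDiffAt
  have hv := hAz.clm_apply hy
  -- On the exceptional locus `A` is the injective derivative `Dh|₀`; by continuity the vector stays
  -- nonzero nearby.
  have hv0 : A z.blowdown (replaceOne j (chart 𝕜 m j z)) ≠ 0 := by
    rw [hz, hA0]
    exact (map_ne_zero_iff _ hi).2 (replaceOne_ne_zero _ _)
  refine ((contMDiffAt_point z.line (chart 𝕜 m j z j) hv0).comp z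
    (hμ.prodMk_space hv)).congr_of_eventuallyEq ?_
  filter_upwards [(chart 𝕜 m j).open_source.mem_nhds hj, hv.continuousAt.eventually_ne hv0,
    continuous_blowdown.continuousAt.preimage_mem_nhds hball] with z' hz' hz0 hzb
  have hb : z'.blowdown = chart 𝕜 m j z' j • replaceOne j (chart 𝕜 m j z') := by
    conv_lhs => rw [eq_point z.line hz']
    rfl
  conv_lhs => rw [eq_point z.line hz']
  refine lift_point _ (replaceOne_ne_zero _ _) hz0 ?_ fun h => ?_
  · rw [← hb, hAh _ hzb, ← map_smul, ← hb]
  · change _ = A z'.blowdown _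
    rw [hb, h, zero_smul, hA0]

end BlowupModel

/-! ### Gluing two manifolds -/

section Gluing

/-- The topology on `V` making two partial bijections with topological spaces, with continuous
open transitions, open partial homeomorphisms. -/
@[reducible] def glueTopology {V N₁ N₂ : Type*} [TopologicalSpace N₁] [TopologicalSpace N₂]
    (e₁ : PartialEquiv V N₁) (e₂ : PartialEquiv V N₂) (h₁ : IsOpen e₁.target)
    (h₂ : IsOpen e₂.target) : TopologicalSpace V where
  IsOpen O := IsOpen (e₁.target ∩ e₁.symm ⁻¹' O) ∧ IsOpen (e₂.target ∩ e₂.symm ⁻¹' O)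
  isOpen_univ := by simp [h₁, h₂]
  isOpen_inter s t hs ht := by
    rw [preimage_inter, preimage_inter, inter_inter_distrib_left,
      inter_inter_distrib_left e₂.target]
    exact ⟨hs.1.inter ht.1, hs.2.inter ht.2⟩
  isOpen_sUnion S hS := by
    simp only [preimage_sUnion, inter_iUnion₂]
    exact ⟨isOpen_biUnion fun t ht => (hS t ht).1, isOpen_biUnion fun t ht => (hS t ht).2⟩

/-- The inverse maps are continuous by the choice of topology. An open set pulled back by `e₁` is
open as seen through `e₁` trivially, and through `e₂` because the transition is continuous with open
domain; likewise for `e₂`. -/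
theorem exists_topology_of_partialEquiv {V N₁ N₂ : Type*} [TopologicalSpace N₁]
    [TopologicalSpace N₂] (e₁ : PartialEquiv V N₁) (e₂ : PartialEquiv V N₂)
    (h₁ : IsOpen e₁.target) (h₂ : IsOpen e₂.target) (h₁₂ : IsOpen (e₁.symm.trans e₂).source)
    (h₂₁ : IsOpen (e₂.symm.trans e₁).source)
    (c₁₂ : ContinuousOn (e₁.symm.trans e₂) (e₁.symm.trans e₂).source)
    (c₂₁ : ContinuousOn (e₂.symm.trans e₁) (e₂.symm.trans e₁).source) :
    ∃ (_ : TopologicalSpace V) (E₁ : OpenPartialHomeomorph V N₁)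
      (E₂ : OpenPartialHomeomorph V N₂), E₁.toPartialEquiv = e₁ ∧ E₂.toPartialEquiv = e₂ := by
  let _ : TopologicalSpace V := glueTopology e₁ e₂ h₁ h₂
  have hopen (O : Set V) : IsOpen O ↔
      IsOpen (e₁.target ∩ e₁.symm ⁻¹' O) ∧ IsOpen (e₂.target ∩ e₂.symm ⁻¹' O) := Iff.rfl
  have hs₁ : IsOpen e₁.source := (hopen _).2
    ⟨by rwa [inter_eq_left.2
      (show e₁.target ⊆ e₁.symm ⁻¹' e₁.source from fun x => e₁.map_target)], h₂₁⟩
  have hs₂ : IsOpen e₂.source := (hopen _).2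
    ⟨h₁₂, by rwa [inter_eq_left.2
      (show e₂.target ⊆ e₂.symm ⁻¹' e₂.source from fun x => e₂.map_target)]⟩
  refine ⟨inferInstance,
    { e₁ with
      open_source := hs₁
      open_target := h₁
      continuousOn_toFun := ?_
      continuousOn_invFun := (continuousOn_open_iff h₁).2 fun O hO => ((hopen O).1 hO).1 },
    { e₂ with
      open_source := hs₂
      open_target := h₂
      continuousOn_toFun := ?_
      continuousOn_invFun := (continuousOn_open_iff h₂).2 fun O hO => ((hopen O).1 hO).2 },
    rfl, rfl⟩
  · refine (continuousOn_open_iff hs₁).2 fun W hW => (hopen _).2 ⟨?_, ?_⟩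
    · convert h₁.inter hW using 1
      ext x
      refine and_congr_right fun hx => ⟨fun h => ?_, fun h => ⟨e₁.map_target hx, ?_⟩⟩
      · simpa [e₁.right_inv hx] using h.2
      · simpa [e₁.right_inv hx] using h
    · convert c₂₁.isOpen_inter_preimage h₂₁ hW using 1
      ext x
      simp [and_assoc]
  · refine (continuousOn_open_iff hs₂).2 fun W hW => (hopen _).2 ⟨?_, ?_⟩
    · convert c₁₂.isOpen_inter_preimage h₁₂ hW using 1
      ext x
      simp [and_assoc]
    · convert h₂.inter hW using 1
      ext x
      refine and_congr_right fun hx => ⟨fun h => ?_, fun h => ⟨e₂.map_target hx, ?_⟩⟩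
      · simpa [e₂.right_inv hx] using h.2
      · simpa [e₂.right_inv hx] using h

/-! ### Smooth transitions and the glued atlas -/

variable {𝕜 : Type*} [NontriviallyNormedField 𝕜] {E : Type*} [NormedAddCommGroup E]
  [NormedSpace 𝕜 E] {V N N₁ N₂ : Type*} [TopologicalSpace V]
  [TopologicalSpace N] [ChartedSpace E N]
  [TopologicalSpace N₁] [ChartedSpace E N₁] [TopologicalSpace N₂] [ChartedSpace E N₂]

variable (𝕜 E) in
/-- The transition from `e₁` to `e₂` is smooth. -/
def SmoothTransition (e₁ : OpenPartialHomeomorph V N₁) (e₂ : OpenPartialHomeomorph V N₂) : Prop :=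
  ∀ v ∈ e₁.source, v ∈ e₂.source → ContMDiffAt 𝓘(𝕜, E) 𝓘(𝕜, E) ∞ (e₂ ∘ e₁.symm) (e₁ v)

/-- The factorisation through `e` is valid only near points of `e.source`, which need not cover the
overlap of `e₁` and `e₂`; hence the pointwise conclusion. -/
theorem SmoothTransition.contMDiffAt_comp {e₁ : OpenPartialHomeomorph V N₁}
    {e₂ : OpenPartialHomeomorph V N₂} {e : OpenPartialHomeomorph V N}
    (h₁ : SmoothTransition 𝕜 E e₁ e) (h₂ : SmoothTransition 𝕜 E e e₂) {v : V} (hv : v ∈ e.source)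
    (hv₁ : v ∈ e₁.source) (hv₂ : v ∈ e₂.source) :
    ContMDiffAt 𝓘(𝕜, E) 𝓘(𝕜, E) ∞ (e₂ ∘ e₁.symm) (e₁ v) := by
  have h := h₂ v hv hv₂
  rw [show e v = (e ∘ e₁.symm) (e₁ v) by simp [e₁.left_inv hv₁]] at h
  refine (h.comp (e₁ v) (h₁ v hv₁ hv)).congr_of_eventuallyEq ?_
  have : ∀ᶠ x in 𝓝 (e₁ v), e₁.symm x ∈ e.source :=
    (e₁.continuousAt_symm (e₁.map_source hv₁)).preimage_mem_nhds
      (e.open_source.mem_nhds (by rwa [e₁.left_inv hv₁]))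
  filter_upwards [this] with x hx
  simp [e.left_inv hx]

theorem smoothTransition_trans_chart [IsManifold 𝓘(𝕜, E) ∞ N] (e : OpenPartialHomeomorph V N)
    {c : OpenPartialHomeomorph N E} (hc : c ∈ IsManifold.maximalAtlas 𝓘(𝕜, E) ∞ N) :
    SmoothTransition 𝕜 E e (e ≫ₕ c) ∧ SmoothTransition 𝕜 E (e ≫ₕ c) e := by
  constructor
  · intro v hv hv'
    refine (contMDiffAt_of_mem_maximalAtlas hc hv'.2).congr_of_eventuallyEq ?_
    filter_upwards [e.open_target.mem_nhds (e.map_source hv)] with x hx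
    simp [e.right_inv hx]
  · intro v hv hv'
    have hx := (e ≫ₕ c).map_source hv
    refine (contMDiffAt_symm_of_mem_maximalAtlas hc hx.1).congr_of_eventuallyEq ?_
    filter_upwards [(e ≫ₕ c).open_target.mem_nhds hx] with x hx
    simpa using e.right_inv hx.2

theorem contMDiffOn_of_smoothTransition [ChartedSpace E V] [IsManifold 𝓘(𝕜, E) ∞ V]
    (e : OpenPartialHomeomorph V N) (h : ∀ v, SmoothTransition 𝕜 E (chartAt E v) e) :
    ContMDiffOn 𝓘(𝕜, E) 𝓘(𝕜, E) ∞ e e.source := by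
  intro v hv
  refine ContMDiffAt.contMDiffWithinAt ?_
  have hs := mem_chart_source E v
  refine ((h v v hs hv).comp v (contMDiffAt_of_mem_maximalAtlas
    (IsManifold.chart_mem_maximalAtlas v) hs)).congr_of_eventuallyEq ?_
  filter_upwards [(chartAt E v).open_source.mem_nhds hs] with w hw
  exact congrArg e ((chartAt E v).left_inv hw).symm

theorem contMDiffOn_symm_of_smoothTransition [ChartedSpace E V] [IsManifold 𝓘(𝕜, E) ∞ V]
    (e : OpenPartialHomeomorph V N) (h : ∀ v, SmoothTransition 𝕜 E e (chartAt E v)) :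
    ContMDiffOn 𝓘(𝕜, E) 𝓘(𝕜, E) ∞ e.symm e.target := by
  intro x hx
  refine ContMDiffAt.contMDiffWithinAt ?_
  have hs := mem_chart_source E (e.symm x)
  have h1 := h (e.symm x) (e.symm x) (e.map_target hx) hs
  rw [e.right_inv hx] at h1
  refine (ContMDiffAt.comp (g := (chartAt E (e.symm x)).symm) x
    (contMDiffAt_symm_of_mem_maximalAtlas (IsManifold.chart_mem_maximalAtlas (e.symm x))
      ((chartAt E (e.symm x)).map_source hs)) h1).congr_of_eventuallyEq ?_
  filter_upwards [(e.continuousAt_symm hx).preimage_mem_nhds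
    ((chartAt E (e.symm x)).open_source.mem_nhds hs)] with y hy
  exact ((chartAt E (e.symm x)).left_inv hy).symm

/-- Two manifolds glued along smooth transitions form a manifold. -/
theorem exists_chartedSpace_of_smoothTransition [IsManifold 𝓘(𝕜, E) ∞ N₁]
    [IsManifold 𝓘(𝕜, E) ∞ N₂] (e₁ : OpenPartialHomeomorph V N₁)
    (e₂ : OpenPartialHomeomorph V N₂) (hcov : ∀ v, v ∈ e₁.source ∨ v ∈ e₂.source)
    (h₁₂ : SmoothTransition 𝕜 E e₁ e₂) (h₂₁ : SmoothTransition 𝕜 E e₂ e₁) :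
    ∃ _ : ChartedSpace E V, IsManifold 𝓘(𝕜, E) ∞ V ∧
      ContMDiffOn 𝓘(𝕜, E) 𝓘(𝕜, E) ∞ e₁ e₁.source ∧
      ContMDiffOn 𝓘(𝕜, E) 𝓘(𝕜, E) ∞ e₁.symm e₁.target ∧
      ContMDiffOn 𝓘(𝕜, E) 𝓘(𝕜, E) ∞ e₂ e₂.source ∧
      ContMDiffOn 𝓘(𝕜, E) 𝓘(𝕜, E) ∞ e₂.symm e₂.target := by
  classical
  -- The atlas consists of all charts compatible with both `e₁` and `e₂` in both directions, so the
  -- four smoothness claims can be read off from membership.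
  let A : Set (OpenPartialHomeomorph V E) := {e |
    (SmoothTransition 𝕜 E e₁ e ∧ SmoothTransition 𝕜 E e e₁) ∧
    (SmoothTransition 𝕜 E e₂ e ∧ SmoothTransition 𝕜 E e e₂)}
  have hA : ∀ v, ∃ e ∈ A, v ∈ e.source := by
    intro v
    rcases hcov v with hv | hv
    · have h := smoothTransition_trans_chart e₁
        (IsManifold.chart_mem_maximalAtlas (I := 𝓘(𝕜, E)) (n := ∞) (e₁ v))
      refine ⟨e₁ ≫ₕ chartAt E (e₁ v), ⟨h, ?_, ?_⟩, hv, mem_chart_source E (e₁ v)⟩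
      · exact fun w hw hw' => h₂₁.contMDiffAt_comp h.1 hw'.1 hw hw'
      · exact fun w hw hw' => h.2.contMDiffAt_comp h₁₂ hw.1 hw hw'
    · have h := smoothTransition_trans_chart e₂
        (IsManifold.chart_mem_maximalAtlas (I := 𝓘(𝕜, E)) (n := ∞) (e₂ v))
      refine ⟨e₂ ≫ₕ chartAt E (e₂ v), ⟨⟨?_, ?_⟩, h⟩, hv, mem_chart_source E (e₂ v)⟩
      · exact fun w hw hw' => h₁₂.contMDiffAt_comp h.1 hw'.1 hw hw'
      · exact fun w hw hw' => h.2.contMDiffAt_comp h₂₁ hw.1 hw hw'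
  choose c hcA hcs using hA
  let _ : ChartedSpace E V :=
    { atlas := A
      chartAt := c
      mem_chart_source := hcs
      chart_mem_atlas := hcA }
  -- Two charts are compared at a point through whichever of `e₁`, `e₂` is defined there.
  have htrans : ∀ e ∈ A, ∀ e' ∈ A, SmoothTransition 𝕜 E e e' := by
    intro e he e' he' v hv hv'
    rcases hcov v with h | h
    · exact he.1.2.contMDiffAt_comp he'.1.1 h hv hv'
    · exact he.2.2.contMDiffAt_comp he'.2.1 h hv hv'
  have hM : IsManifold 𝓘(𝕜, E) ∞ V := by
    refine isManifold_of_contDiffOn _ _ _ fun e e' he he' x hx => ?_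
    simp only [mfld_simps] at hx
    have := htrans e he e' he' (e.symm x) (e.map_target hx.1) hx.2
    rw [e.right_inv hx.1] at this
    exact this.contDiffAt.contDiffWithinAt
  exact ⟨inferInstance, hM, contMDiffOn_of_smoothTransition e₁ fun v => (hcA v).1.2,
    contMDiffOn_symm_of_smoothTransition e₁ fun v => (hcA v).1.1,
    contMDiffOn_of_smoothTransition e₂ fun v => (hcA v).2.2,
    contMDiffOn_symm_of_smoothTransition e₂ fun v => (hcA v).2.1⟩

end Gluing

/-! ### Centred charts -/

section Centred

variable {𝕜 : Type*} [RCLike 𝕜] {m : ℕ} {M : Type*} [TopologicalSpace M]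
  [ChartedSpace (EuclideanSpace 𝕜 (Fin m)) M]

/-- A chart of the maximal atlas of `M` which is defined at `p` and maps it to `0`. -/
structure IsCentredChart (p : M) (φ : OpenPartialHomeomorph M (EuclideanSpace 𝕜 (Fin m))) :
    Prop where
  mem_maximalAtlas : φ ∈ IsManifold.maximalAtlas 𝓘(𝕜, EuclideanSpace 𝕜 (Fin m)) ∞ M
  mem_source : p ∈ φ.source
  map_eq_zero : φ p = 0

variable (𝕜 m) in
theorem exists_isCentredChart [IsManifold 𝓘(𝕜, EuclideanSpace 𝕜 (Fin m)) ∞ M] (p : M) :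
    ∃ φ : OpenPartialHomeomorph M (EuclideanSpace 𝕜 (Fin m)), IsCentredChart p φ := by
  set c := chartAt (EuclideanSpace 𝕜 (Fin m)) p
  have hc : c ∈ IsManifold.maximalAtlas 𝓘(𝕜, EuclideanSpace 𝕜 (Fin m)) ∞ M :=
    IsManifold.chart_mem_maximalAtlas p
  refine ⟨c.transHomeomorph (Homeomorph.subRight (c p)),
    OpenPartialHomeomorph.mem_maximalAtlas_of_contMDiffOn _ ?_ ?_, mem_chart_source _ p, ?_⟩
  · exact (contDiff_id.sub contDiff_const).contMDiff.comp_contMDiffOn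
      (contMDiffOn_of_mem_maximalAtlas hc)
  · refine (contMDiffOn_symm_of_mem_maximalAtlas hc).comp
      (contDiff_id.add contDiff_const).contMDiff.contMDiffOn fun x hx => ?_
    simpa [sub_eq_add_neg] using hx
  · simp

namespace IsCentredChart

variable {p : M} {φ ψ χ : OpenPartialHomeomorph M (EuclideanSpace 𝕜 (Fin m))}

theorem zero_mem_target (hφ : IsCentredChart p φ) : (0 : EuclideanSpace 𝕜 (Fin m)) ∈ φ.target :=
  hφ.map_eq_zero ▸ φ.map_source hφ.mem_source

theorem symm_zero (hφ : IsCentredChart p φ) : φ.symm 0 = p := by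
  rw [← hφ.map_eq_zero, φ.left_inv hφ.mem_source]

theorem apply_ne_zero (hφ : IsCentredChart p φ) {a : M} (ha : a ∈ φ.source) (hap : a ≠ p) :
    φ a ≠ 0 := fun h => hap (by rw [← φ.left_inv ha, h, hφ.symm_zero])

theorem symm_apply_ne (hφ : IsCentredChart p φ) {x : EuclideanSpace 𝕜 (Fin m)}
    (hx : x ∈ φ.target) (hx0 : x ≠ 0) : φ.symm x ≠ p :=
  fun h => hx0 (by rw [← φ.right_inv hx, h, hφ.map_eq_zero])

theorem transition_zero (hφ : IsCentredChart p φ) (hψ : IsCentredChart p ψ) :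
    (ψ ∘ φ.symm) 0 = 0 := by
  simp [hφ.symm_zero, hψ.map_eq_zero]

theorem exists_contDiffOn_ball (hφ : IsCentredChart p φ) (hψ : IsCentredChart p ψ) :
    ∃ r > 0, ContDiffOn 𝕜 ∞ (ψ ∘ φ.symm) (Metric.ball 0 r) := by
  have h0 : (0 : EuclideanSpace 𝕜 (Fin m)) ∈ (φ.symm ≫ₕ ψ).source :=
    ⟨hφ.zero_mem_target, by simpa [hφ.symm_zero] using hψ.mem_source⟩
  obtain ⟨r, hr, hsub⟩ := Metric.isOpen_iff.1 (φ.symm ≫ₕ ψ).open_source 0 h0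
  refine ⟨r, hr, ContDiffOn.mono ?_ hsub⟩
  rw [← contMDiffOn_iff_contDiffOn]
  exact (contMDiffOn_of_mem_maximalAtlas hψ.mem_maximalAtlas).comp
    ((contMDiffOn_symm_of_mem_maximalAtlas hφ.mem_maximalAtlas).mono fun x hx => hx.1)
    fun x hx => hx.2

theorem differentiableAt_transition (hφ : IsCentredChart p φ) (hψ : IsCentredChart p ψ) :
    DifferentiableAt 𝕜 (ψ ∘ φ.symm) 0 := by
  obtain ⟨r, hr, h⟩ := hφ.exists_contDiffOn_ball hψ
  exact (h.differentiableOn (by simp)).differentiableAt (Metric.ball_mem_nhds _ hr)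

/-- The inner `ψ.symm ∘ ψ` cancels only on `ψ.source`; equality near `0` is enough for derivatives
at `0`. -/
theorem transition_comp_eventuallyEq (hφ : IsCentredChart p φ) (hψ : IsCentredChart p ψ) :
    χ ∘ φ.symm =ᶠ[𝓝 0] (χ ∘ ψ.symm) ∘ (ψ ∘ φ.symm) := by
  have : ∀ᶠ x in 𝓝 (0 : EuclideanSpace 𝕜 (Fin m)), φ.symm x ∈ ψ.source :=
    (φ.continuousAt_symm hφ.zero_mem_target).preimage_mem_nhds
      (ψ.open_source.mem_nhds (by simpa [hφ.symm_zero] using hψ.mem_source))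
  filter_upwards [this] with x hx
  simp [ψ.left_inv hx]

theorem transition_self_eventuallyEq (hφ : IsCentredChart p φ) : φ ∘ φ.symm =ᶠ[𝓝 0] id := by
  filter_upwards [φ.open_target.mem_nhds hφ.zero_mem_target] with x hx
  exact φ.right_inv hx

/-- By the chain rule the derivative of the reverse transition is a left inverse. -/
theorem injective_fderiv_transition (hφ : IsCentredChart p φ) (hψ : IsCentredChart p ψ) :
    Function.Injective (fderiv 𝕜 (ψ ∘ φ.symm) 0) := by
  have h := ((hφ.transition_comp_eventuallyEq hψ).symm.trans
    hφ.transition_self_eventuallyEq).fderiv_eq (𝕜 := 𝕜)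
  rw [fderiv_comp _ (by
    rw [hφ.transition_zero hψ]
    exact hψ.differentiableAt_transition hφ) (hφ.differentiableAt_transition hψ), fderiv_id] at h
  exact Function.LeftInverse.injective fun x => DFunLike.congr_fun h x

theorem contMDiffAt_lift_transition (hφ : IsCentredChart p φ) (hψ : IsCentredChart p ψ)
    {z : BlowupModel 𝕜 m} (hz : z.blowdown = 0) :
    ContMDiffAt 𝓘(𝕜, EuclideanSpace 𝕜 (Fin m)) 𝓘(𝕜, EuclideanSpace 𝕜 (Fin m)) ∞
      (BlowupModel.lift (ψ ∘ φ.symm)) z := by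
  obtain ⟨r, hr, h⟩ := hφ.exists_contDiffOn_ball hψ
  exact BlowupModel.contMDiffAt_lift hr h (hφ.transition_zero hψ)
    (hφ.injective_fderiv_transition hψ) hz

theorem lift_lift_transition (hφ : IsCentredChart p φ) (hψ : IsCentredChart p ψ)
    (hχ : IsCentredChart p χ) {z : BlowupModel 𝕜 m} (hz : z.blowdown = 0) :
    BlowupModel.lift (χ ∘ ψ.symm) (BlowupModel.lift (ψ ∘ φ.symm) z) =
      BlowupModel.lift (χ ∘ φ.symm) z :=
  BlowupModel.lift_lift_of_blowdown_eq_zero hz (hφ.transition_zero hψ)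
    (hψ.differentiableAt_transition hχ) (hφ.differentiableAt_transition hψ)
    (hψ.injective_fderiv_transition hχ) (hφ.injective_fderiv_transition hψ)
    (hφ.transition_comp_eventuallyEq hψ)

theorem lift_transition_self (hφ : IsCentredChart p φ) {z : BlowupModel 𝕜 m}
    (hz : z.blowdown ∈ φ.target) : BlowupModel.lift (φ ∘ φ.symm) z = z := by
  by_cases h0 : z.blowdown = 0
  · exact BlowupModel.lift_eq_self_of_blowdown_eq_zero h0 hφ.transition_self_eventuallyEq
  · rw [BlowupModel.lift_of_blowdown_ne_zero _ h0, Function.comp_apply, φ.right_inv hz]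
    exact (BlowupModel.eq_point_blowdown _ h0).symm

end IsCentredChart

end Centred

/-! ### The blowup of a manifold at a point -/

section BlowupSet

variable {𝕜 : Type v} [RCLike 𝕜] {m : ℕ} {M : Type u}

/-- The set underlying the blowup of `M` at `p`. -/
abbrev BlowupSet (𝕜 : Type v) [RCLike 𝕜] (m : ℕ) {M : Type u} (p : M) : Type (max u v) :=
  {a : M // a ≠ p} ⊕ ℙ 𝕜 (EuclideanSpace 𝕜 (Fin m))

namespace BlowupSet

variable {p : M}

/-- The blowdown map. -/
def proj : BlowupSet 𝕜 m p → M := Sum.elim Subtype.val fun _ => p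

/-- The point over `a`, given by the line `l` if `a = p`. -/
def ofLine (p a : M) (l : ℙ 𝕜 (EuclideanSpace 𝕜 (Fin m))) : BlowupSet 𝕜 m p :=
  open Classical in if h : a = p then Sum.inr l else Sum.inl ⟨a, h⟩

theorem ofLine_self (l : ℙ 𝕜 (EuclideanSpace 𝕜 (Fin m))) : ofLine p p l = Sum.inr l := dif_pos rfl

theorem ofLine_of_ne {a : M} (h : a ≠ p) (l : ℙ 𝕜 (EuclideanSpace 𝕜 (Fin m))) :
    ofLine p a l = Sum.inl ⟨a, h⟩ := dif_neg h

@[simp] theorem proj_ofLine (a : M) (l : ℙ 𝕜 (EuclideanSpace 𝕜 (Fin m))) :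
    proj (ofLine p a l) = a := by
  by_cases h : a = p
  · subst h
    rw [ofLine_self]
    rfl
  · rw [ofLine_of_ne h]
    rfl

/-- The identification of the complement of the exceptional locus with `M ∖ {p}`. -/
def complEquiv (p : M) (l : ℙ 𝕜 (EuclideanSpace 𝕜 (Fin m))) :
    PartialEquiv (BlowupSet 𝕜 m p) M where
  toFun := proj
  -- The line `l` is a default that matters only at `a = p`, outside the target.
  invFun a := ofLine p a l
  source := proj ⁻¹' {p}ᶜ
  target := {p}ᶜ
  map_source' _ hv := hv
  map_target' a ha := by simpa using ha
  left_inv' := by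
    rintro (a | l') hv
    · exact ofLine_of_ne a.2 l
    · exact absurd rfl hv
  right_inv' a _ := proj_ofLine a l

end BlowupSet

end BlowupSet

/-! ### Construction of the glued manifold -/

section Blowup

open BlowupModel

variable {𝕜 : Type v} [RCLike 𝕜] {m : ℕ} {M : Type u} [TopologicalSpace M]
  [ChartedSpace (EuclideanSpace 𝕜 (Fin m)) M]

/-- `V` is glued from `M ∖ {p}` and the part of the model over the target of a chart `φ` centred at
`p`, by means of the partial homeomorphisms `E₁` and `E₂`; the blowdown map is `E₁`. -/
structure IsGluedBlowup {V : Type*} [TopologicalSpace V]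
    [ChartedSpace (EuclideanSpace 𝕜 (Fin m)) V] (p : M)
    (φ : OpenPartialHomeomorph M (EuclideanSpace 𝕜 (Fin m))) (E₁ : OpenPartialHomeomorph V M)
    (E₂ : OpenPartialHomeomorph V (BlowupModel 𝕜 m)) : Prop where
  centred : IsCentredChart p φ
  source₁ : E₁.source = E₁ ⁻¹' {p}ᶜ
  target₁ : E₁.target = {p}ᶜ
  source₂ : E₂.source = E₁ ⁻¹' φ.source
  target₂ : E₂.target = blowdown ⁻¹' φ.target
  blowdown₂ : ∀ v ∈ E₂.source, (E₂ v).blowdown = φ (E₁ v)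
  contMDiffOn₁ : ContMDiffOn 𝓘(𝕜, EuclideanSpace 𝕜 (Fin m)) 𝓘(𝕜, EuclideanSpace 𝕜 (Fin m)) ∞
    E₁ E₁.source
  contMDiffOn_symm₁ : ContMDiffOn 𝓘(𝕜, EuclideanSpace 𝕜 (Fin m))
    𝓘(𝕜, EuclideanSpace 𝕜 (Fin m)) ∞ E₁.symm E₁.target
  contMDiffOn₂ : ContMDiffOn 𝓘(𝕜, EuclideanSpace 𝕜 (Fin m)) 𝓘(𝕜, EuclideanSpace 𝕜 (Fin m)) ∞
    E₂ E₂.source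
  contMDiffOn_symm₂ : ContMDiffOn 𝓘(𝕜, EuclideanSpace 𝕜 (Fin m))
    𝓘(𝕜, EuclideanSpace 𝕜 (Fin m)) ∞ E₂.symm E₂.target

/-- The identification of a neighbourhood of the exceptional locus with part of the model. -/
def BlowupSet.modelEquiv {p : M}
    {φ : OpenPartialHomeomorph M (EuclideanSpace 𝕜 (Fin m))} (hφ : IsCentredChart p φ)
    (l : ℙ 𝕜 (EuclideanSpace 𝕜 (Fin m))) :
    PartialEquiv (BlowupSet 𝕜 m p) (BlowupModel 𝕜 m) where
  -- On the source `φ a ≠ 0` for `a ≠ p`, so the default line `l` is not seen there.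
  toFun := Sum.elim (fun a => point l 1 (φ a)) zeroSection
  invFun z := BlowupSet.ofLine p (φ.symm z.blowdown) z.line
  source := BlowupSet.proj ⁻¹' φ.source
  target := blowdown ⁻¹' φ.target
  map_source' := by
    rintro (a | l') hv
    · change (1 : 𝕜) • φ a ∈ φ.target
      rw [one_smul]
      exact φ.map_source hv
    · simpa using hφ.zero_mem_target
  map_target' z hz := by simpa using φ.map_target hz
  left_inv' := by
    rintro (a | l') hv
    · have : φ.symm (φ a) = a := φ.left_inv hv
      simp only [Sum.elim_inl, blowdown_point, one_smul, this]
      exact BlowupSet.ofLine_of_ne a.2 _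
    · simp [hφ.symm_zero, BlowupSet.ofLine_self]
  right_inv' z hz := by
    by_cases h0 : z.blowdown = 0
    · simp [h0, hφ.symm_zero, BlowupSet.ofLine_self, zeroSection_line h0]
    · rw [BlowupSet.ofLine_of_ne (hφ.symm_apply_ne hz h0)]
      simp only [Sum.elim_inl, φ.right_inv hz]
      exact (eq_point_blowdown l h0).symm

-- The transition `a ↦ (φ a, [φ a])` is smooth because `φ a ≠ 0` on the overlap, and its inverse is
-- `φ.symm ∘ blowdown`. The Hausdorff property of `M` makes `{p}ᶜ` open; `l` only fills in default
-- values.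
variable (𝕜 m) in
theorem exists_isGluedBlowup [T2Space M] [IsManifold 𝓘(𝕜, EuclideanSpace 𝕜 (Fin m)) ∞ M] (p : M)
    (l : ℙ 𝕜 (EuclideanSpace 𝕜 (Fin m))) :
    ∃ (V : Type (max u v)) (_ : TopologicalSpace V)
      (_ : ChartedSpace (EuclideanSpace 𝕜 (Fin m)) V)
      (φ : OpenPartialHomeomorph M (EuclideanSpace 𝕜 (Fin m))) (E₁ : OpenPartialHomeomorph V M)
      (E₂ : OpenPartialHomeomorph V (BlowupModel 𝕜 m)),
      IsManifold 𝓘(𝕜, EuclideanSpace 𝕜 (Fin m)) ∞ V ∧ IsGluedBlowup p φ E₁ E₂ := by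
  obtain ⟨φ, hφ⟩ := exists_isCentredChart 𝕜 m p
  set e₁ := BlowupSet.complEquiv (𝕜 := 𝕜) (m := m) p l
  set e₂ := BlowupSet.modelEquiv hφ l
  have ht₁ : IsOpen e₁.target := isOpen_compl_singleton
  have ht₂ : IsOpen e₂.target := φ.open_target.preimage continuous_blowdown
  have hs₁₂ : (e₁.symm.trans e₂).source = {p}ᶜ ∩ φ.source := by
    ext a
    refine and_congr_right fun _ => ?_
    change BlowupSet.proj (BlowupSet.ofLine p a l) ∈ φ.source ↔ _
    rw [BlowupSet.proj_ofLine]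
  have hs₂₁ : (e₂.symm.trans e₁).source = blowdown ⁻¹' (φ.target ∩ {0}ᶜ) := by
    ext z
    refine and_congr_right fun hz => ?_
    change BlowupSet.proj (BlowupSet.ofLine p (φ.symm z.blowdown) z.line) ∉ ({p} : Set M) ↔ _
    rw [BlowupSet.proj_ofLine]
    refine ⟨fun h h0 => h ?_, fun h => hφ.symm_apply_ne hz h⟩
    rw [show z.blowdown = 0 from h0]
    exact hφ.symm_zero
  have c₁₂ : ContMDiffOn 𝓘(𝕜, EuclideanSpace 𝕜 (Fin m)) 𝓘(𝕜, EuclideanSpace 𝕜 (Fin m)) ∞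
      (e₁.symm.trans e₂) (e₁.symm.trans e₂).source := by
    rw [hs₁₂]
    intro a ha
    refine ContMDiffWithinAt.congr (f := fun a => point l 1 (φ a)) ?_ (fun b hb => ?_) ?_
    · exact ((contMDiffAt_point_one l (hφ.apply_ne_zero ha.2 ha.1)).comp a
        (contMDiffAt_of_mem_maximalAtlas hφ.mem_maximalAtlas ha.2)).contMDiffWithinAt
    · exact congrArg e₂ (BlowupSet.ofLine_of_ne hb.1 l)
    · exact congrArg e₂ (BlowupSet.ofLine_of_ne ha.1 l)
  have c₂₁ : ContMDiffOn 𝓘(𝕜, EuclideanSpace 𝕜 (Fin m)) 𝓘(𝕜, EuclideanSpace 𝕜 (Fin m)) ∞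
      (e₂.symm.trans e₁) (e₂.symm.trans e₁).source := by
    rw [hs₂₁]
    refine ContMDiffOn.congr (f := φ.symm ∘ blowdown) ?_ fun z _ => BlowupSet.proj_ofLine _ _
    exact (contMDiffOn_symm_of_mem_maximalAtlas hφ.mem_maximalAtlas).comp
      contMDiff_blowdown.contMDiffOn fun z hz => hz.1
  have ho₁₂ : IsOpen (e₁.symm.trans e₂).source :=
    hs₁₂ ▸ isOpen_compl_singleton.inter φ.open_source
  have ho₂₁ : IsOpen (e₂.symm.trans e₁).source :=
    hs₂₁ ▸ (φ.open_target.inter isOpen_compl_singleton).preimage continuous_blowdown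
  obtain ⟨tV, E₁, E₂, hE₁, hE₂⟩ := exists_topology_of_partialEquiv e₁ e₂ ht₁ ht₂ ho₁₂ ho₂₁
    c₁₂.continuousOn c₂₁.continuousOn
  have hs₁ : E₁.source = BlowupSet.proj ⁻¹' {p}ᶜ := congrArg PartialEquiv.source hE₁
  have hs₂ : E₂.source = BlowupSet.proj ⁻¹' φ.source := congrArg PartialEquiv.source hE₂
  have hf₁ : ⇑E₁ = BlowupSet.proj := congrArg PartialEquiv.toFun hE₁
  have hf₂ : ⇑E₂ = e₂ := congrArg PartialEquiv.toFun hE₂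
  have hi₁ : ⇑E₁.symm = e₁.symm := congrArg PartialEquiv.invFun hE₁
  have hi₂ : ⇑E₂.symm = e₂.symm := congrArg PartialEquiv.invFun hE₂
  have t₁₂ : SmoothTransition 𝕜 (EuclideanSpace 𝕜 (Fin m)) E₁ E₂ := by
    intro v hv₁ hv₂
    have h := c₁₂.contMDiffAt (x := E₁ v) (ho₁₂.mem_nhds ?_)
    · rw [hf₂, hi₁]
      exact h
    · rw [hs₁₂, hf₁]
      exact ⟨hs₁.subset hv₁, hs₂.subset hv₂⟩
  have t₂₁ : SmoothTransition 𝕜 (EuclideanSpace 𝕜 (Fin m)) E₂ E₁ := by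
    intro v hv₂ hv₁
    have h := c₂₁.contMDiffAt (x := E₂ v) (ho₂₁.mem_nhds ?_)
    · rw [hf₁, hi₂]
      exact h
    · refine ⟨(congrArg PartialEquiv.target hE₂ : E₂.target = _) ▸ E₂.map_source hv₂, ?_⟩
      change e₂.symm (E₂ v) ∈ e₁.source
      rw [← hi₂, E₂.left_inv hv₂]
      exact (congrArg PartialEquiv.source hE₁ : E₁.source = _) ▸ hv₁
  obtain ⟨cV, hV, h₁, h₁', h₂, h₂'⟩ := exists_chartedSpace_of_smoothTransition E₁ E₂ (fun v => by
    rw [hs₁, hs₂]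
    by_cases hv : BlowupSet.proj v = p
    · exact Or.inr (by simpa [hv] using hφ.mem_source)
    · exact Or.inl hv) t₁₂ t₂₁
  refine ⟨BlowupSet 𝕜 m p, tV, cV, φ, E₁, E₂, hV, hφ, ?_, congrArg PartialEquiv.target hE₁, ?_,
    congrArg PartialEquiv.target hE₂, ?_, h₁, h₁', h₂, h₂'⟩
  · rw [hs₁, hf₁]
  · rw [hs₂, hf₁]
  · intro v hv
    rw [hf₂, hf₁]
    rcases v with a | l'
    · exact one_smul _ _
    · exact (blowdown_zeroSection l').trans hφ.map_eq_zero.symm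

/-! ### Topology and smoothness of the blowdown map -/

namespace IsGluedBlowup

variable {𝕜 : Type v} [RCLike 𝕜] {m : ℕ} {M : Type u} [TopologicalSpace M]
  [ChartedSpace (EuclideanSpace 𝕜 (Fin m)) M] {V : Type*} [TopologicalSpace V]
  [ChartedSpace (EuclideanSpace 𝕜 (Fin m)) V] {p : M}
  {φ₀ φ ψ : OpenPartialHomeomorph M (EuclideanSpace 𝕜 (Fin m))} {E₁ : OpenPartialHomeomorph V M}
  {E₂ : OpenPartialHomeomorph V (BlowupModel 𝕜 m)}

theorem apply_symm₁ (h : IsGluedBlowup p φ₀ E₁ E₂) {a : M} (ha : a ≠ p) : E₁ (E₁.symm a) = a :=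
  E₁.right_inv (h.target₁ ▸ ha)

theorem mem_source₁ (h : IsGluedBlowup p φ₀ E₁ E₂) {v : V} (hv : E₁ v ≠ p) : v ∈ E₁.source :=
  h.source₁ ▸ hv

theorem mem_source₂ (h : IsGluedBlowup p φ₀ E₁ E₂) {v : V} (hv : E₁ v ∈ φ₀.source) :
    v ∈ E₂.source := h.source₂ ▸ hv

theorem mem_source₂_of_eq (h : IsGluedBlowup p φ₀ E₁ E₂) {v : V} (hv : E₁ v = p) :
    v ∈ E₂.source := h.mem_source₂ (hv ▸ h.centred.mem_source)

theorem blowdown₂_of_eq (h : IsGluedBlowup p φ₀ E₁ E₂) {v : V} (hv : E₁ v = p) :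
    (E₂ v).blowdown = 0 := by
  rw [h.blowdown₂ v (h.mem_source₂_of_eq hv), hv, h.centred.map_eq_zero]

theorem apply_symm₂ (h : IsGluedBlowup p φ₀ E₁ E₂) {z : BlowupModel 𝕜 m}
    (hz : z.blowdown ∈ φ₀.target) : E₁ (E₂.symm z) = φ₀.symm z.blowdown := by
  have hz' : z ∈ E₂.target := h.target₂ ▸ hz
  have hs := E₂.map_target hz'
  have hb := h.blowdown₂ _ hs
  rw [E₂.right_inv hz'] at hb
  rw [hb, φ₀.left_inv]
  rw [h.source₂] at hs
  exact hs

theorem mem_target₂ (h : IsGluedBlowup p φ₀ E₁ E₂) {z : BlowupModel 𝕜 m}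
    (hz : z.blowdown = 0) : z ∈ E₂.target := by
  rw [h.target₂, mem_preimage, hz]
  exact h.centred.zero_mem_target

theorem apply_symm₂_of_eq_zero (h : IsGluedBlowup p φ₀ E₁ E₂) {z : BlowupModel 𝕜 m}
    (hz : z.blowdown = 0) : E₁ (E₂.symm z) = p := by
  rw [h.apply_symm₂ (by rw [hz]; exact h.centred.zero_mem_target), hz, h.centred.symm_zero]

theorem apply₂_of_ne (h : IsGluedBlowup p φ₀ E₁ E₂) (l : ℙ 𝕜 (EuclideanSpace 𝕜 (Fin m))) {v : V}
    (hv : E₁ v ∈ φ₀.source) (hvp : E₁ v ≠ p) : E₂ v = point l 1 (φ₀ (E₁ v)) := by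
  have hb := h.blowdown₂ v (h.mem_source₂ hv)
  rw [← hb]
  exact eq_point_blowdown l (hb ▸ h.centred.apply_ne_zero hv hvp)

theorem contMDiffAt₁ (h : IsGluedBlowup p φ₀ E₁ E₂) {v : V} (hv : E₁ v ≠ p) :
    ContMDiffAt 𝓘(𝕜, EuclideanSpace 𝕜 (Fin m)) 𝓘(𝕜, EuclideanSpace 𝕜 (Fin m)) ∞ E₁ v :=
  h.contMDiffOn₁.contMDiffAt (E₁.open_source.mem_nhds (h.mem_source₁ hv))

/-- The blowdown map is smooth. -/
theorem contMDiff (h : IsGluedBlowup p φ₀ E₁ E₂) :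
    ContMDiff 𝓘(𝕜, EuclideanSpace 𝕜 (Fin m)) 𝓘(𝕜, EuclideanSpace 𝕜 (Fin m)) ∞ E₁ := by
  intro v
  by_cases hv : E₁ v = p
  · have hs := h.mem_source₂_of_eq hv
    have hz : (E₂ v).blowdown ∈ φ₀.target := by
      rw [h.blowdown₂_of_eq hv]
      exact h.centred.zero_mem_target
    -- Near the exceptional locus `E₁ = φ₀.symm ∘ blowdown ∘ E₂`.
    have h1 := contMDiffAt_symm_of_mem_maximalAtlas h.centred.mem_maximalAtlas hz
    refine (h1.comp v (contMDiff_blowdown.contMDiffAt.comp v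
      (h.contMDiffOn₂.contMDiffAt (E₂.open_source.mem_nhds hs)))).congr_of_eventuallyEq ?_
    filter_upwards [E₂.open_source.mem_nhds hs] with w hw
    have hw' : E₁ w ∈ φ₀.source := h.source₂.subset hw
    simp [h.blowdown₂ w hw, φ₀.left_inv hw']
  · exact h.contMDiffAt₁ hv

/-- Points with different images are separated in `M`; distinct points with the same image lie over
`p`, hence in `E₂.source`, and are separated in the Hausdorff model. -/
theorem t2Space [T2Space M] (h : IsGluedBlowup p φ₀ E₁ E₂) : T2Space V := by
  refine ⟨fun v w hvw => ?_⟩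
  by_cases heq : E₁ v = E₁ w
  · by_cases hv : E₁ v = p
    · have hsv := h.mem_source₂_of_eq hv
      have hsw := h.mem_source₂_of_eq (heq ▸ hv)
      obtain ⟨A, B, hA, hB, hvA, hwB, hAB⟩ := t2_separation (E₂.injOn.ne hsv hsw hvw)
      exact ⟨_, _, E₂.isOpen_inter_preimage hA, E₂.isOpen_inter_preimage hB, ⟨hsv, hvA⟩,
        ⟨hsw, hwB⟩, (hAB.preimage E₂).mono inter_subset_right inter_subset_right⟩
    · exact absurd (E₁.injOn (h.mem_source₁ hv) (h.mem_source₁ (heq ▸ hv)) heq) hvw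
  · exact separated_by_continuous h.contMDiff.continuous heq

theorem secondCountableTopology (h : IsGluedBlowup p φ₀ E₁ E₂) [SecondCountableTopology M] :
    SecondCountableTopology V := by
  have h₁ : SecondCountableTopology E₁.source :=
    E₁.toHomeomorphSourceTarget.secondCountableTopology
  have h₂ : SecondCountableTopology E₂.source :=
    E₂.toHomeomorphSourceTarget.secondCountableTopology
  let U : Bool → Set V := fun b => cond b E₁.source E₂.source
  have hU : ∀ b, SecondCountableTopology (U b) := by
    rintro (_ | _)
    exacts [h₂, h₁]
  refine TopologicalSpace.secondCountableTopology_of_countable_cover (U := U) ?_ ?_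
  · rintro (_ | _)
    exacts [E₂.open_source, E₁.open_source]
  · refine eq_univ_of_forall fun v => mem_iUnion.2 ?_
    by_cases hv : E₁ v = p
    · exact ⟨false, h.mem_source₂_of_eq hv⟩
    · exact ⟨true, h.mem_source₁ hv⟩

/-- The exceptional locus is the image of the zero section. -/
theorem range_symm_zeroSection (h : IsGluedBlowup p φ₀ E₁ E₂) :
    range (E₂.symm ∘ zeroSection) = E₁ ⁻¹' {p} := by
  ext v
  constructor
  · rintro ⟨l, rfl⟩
    exact h.apply_symm₂_of_eq_zero (blowdown_zeroSection l)
  · intro hv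
    refine ⟨(E₂ v).line, ?_⟩
    rw [Function.comp_apply, zeroSection_line (h.blowdown₂_of_eq hv),
      E₂.left_inv (h.mem_source₂_of_eq hv)]

theorem continuous_symm_zeroSection (h : IsGluedBlowup p φ₀ E₁ E₂) :
    Continuous (E₂.symm ∘ zeroSection) :=
  E₂.continuousOn_symm.comp_continuous continuous_zeroSection
    fun l => h.mem_target₂ (blowdown_zeroSection l)

/-- Away from `p` the map is a local homeomorphism. At `p`, an open preimage contains the
exceptional locus and so, by the tube argument, every point over a neighbourhood of `p`. The line
`l` gives a point over `p` for surjectivity. -/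
theorem isQuotientMap [T2Space M] (h : IsGluedBlowup p φ₀ E₁ E₂)
    (l : ℙ 𝕜 (EuclideanSpace 𝕜 (Fin m))) : IsQuotientMap E₁ := by
  rw [isQuotientMap_iff]
  refine ⟨.of_isOpen_preimage_iff_isOpen fun O =>
    ⟨fun hO => ?_, fun hO => hO.preimage h.contMDiff.continuous⟩, fun a => ?_⟩
  rotate_left
  · by_cases ha : a = p
    · exact ⟨E₂.symm (zeroSection l), ha ▸ h.apply_symm₂_of_eq_zero (blowdown_zeroSection l)⟩
    · exact ⟨E₁.symm a, h.apply_symm₁ ha⟩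
  · rw [isOpen_iff_mem_nhds]
    intro a ha
    by_cases hap : a = p
    · subst hap
      have hW := E₂.symm.isOpen_inter_preimage hO
      have hev := eventually_forall_mem_of_isOpen hW fun z hz =>
        ⟨h.mem_target₂ hz, by simpa [h.apply_symm₂_of_eq_zero hz] using ha⟩
      rw [← h.centred.map_eq_zero] at hev
      filter_upwards [(φ₀.continuousAt h.centred.mem_source).eventually hev,
        φ₀.open_source.mem_nhds h.centred.mem_source] with b hb hbs
      -- Any point over `φ₀ b` will do; this one also exists when `b = p`, thanks to the default
      -- line.
      have := (hb (point l 1 (φ₀ b)) (by simp)).2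
      rw [mem_preimage, mem_preimage, h.apply_symm₂ (by simpa using φ₀.map_source hbs)] at this
      simpa [φ₀.left_inv hbs] using this
    · have hs : E₁.symm a ∈ E₁.source := E₁.map_target (h.target₁ ▸ hap)
      refine Filter.mem_of_superset ((E₁.isOpen_image_source_inter hO).mem_nhds
        ⟨E₁.symm a, ⟨hs, ?_⟩, h.apply_symm₁ hap⟩) ?_
      · rwa [mem_preimage, h.apply_symm₁ hap]
      · rintro _ ⟨v, hv, rfl⟩
        exact hv.2

/-- The blowdown map as a diffeomorphism away from the exceptional locus. -/
def diffeomorph [T2Space M] (h : IsGluedBlowup p φ₀ E₁ E₂) :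
    Diffeomorph 𝓘(𝕜, EuclideanSpace 𝕜 (Fin m)) 𝓘(𝕜, EuclideanSpace 𝕜 (Fin m))
      (Opens.comap ⟨E₁, h.contMDiff.continuous⟩ ⟨{p}ᶜ, isOpen_compl_singleton⟩ : Opens V)
      (⟨{p}ᶜ, isOpen_compl_singleton⟩ : Opens M) ∞ where
  toFun x := ⟨E₁ x, x.2⟩
  invFun a := ⟨E₁.symm a, show E₁ (E₁.symm a) ≠ p from (h.apply_symm₁ a.2).symm ▸ a.2⟩
  left_inv x := Subtype.ext (E₁.left_inv (h.mem_source₁ x.2))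
  right_inv a := Subtype.ext (h.apply_symm₁ a.2)
  contMDiff_toFun := by
    rw [← ContMDiff.subtypeVal_comp_iff]
    exact h.contMDiff.comp contMDiff_subtype_val
  contMDiff_invFun := by
    rw [← ContMDiff.subtypeVal_comp_iff]
    exact h.contMDiffOn_symm₁.comp_contMDiff contMDiff_subtype_val
      fun a => by rw [h.target₁]; exact a.2

/-! ### Lifted charts -/

open Classical in
/-- The lift of a chart to the blowup. -/
def liftedChart (φ₀ : OpenPartialHomeomorph M (EuclideanSpace 𝕜 (Fin m)))
    (E₁ : OpenPartialHomeomorph V M) (E₂ : OpenPartialHomeomorph V (BlowupModel 𝕜 m)) (p : M)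
    (φ : OpenPartialHomeomorph M (EuclideanSpace 𝕜 (Fin m))) (v : V) : BlowupModel 𝕜 m :=
  -- The second branch avoids `φ₀`, so the lift makes sense over all of `φ.source` and not only over
  -- `φ.source ∩ φ₀.source`.
  if E₁ v = p then lift (φ ∘ φ₀.symm) (E₂ v) else point (E₂ v).line 1 (φ (E₁ v))

open Classical in
/-- The inverse of the lift of a chart to the blowup. -/
def liftedChartSymm (φ₀ : OpenPartialHomeomorph M (EuclideanSpace 𝕜 (Fin m)))
    (E₁ : OpenPartialHomeomorph V M) (E₂ : OpenPartialHomeomorph V (BlowupModel 𝕜 m))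
    (φ : OpenPartialHomeomorph M (EuclideanSpace 𝕜 (Fin m))) (z : BlowupModel 𝕜 m) : V :=
  if z.blowdown = 0 then E₂.symm (lift (φ₀ ∘ φ.symm) z) else E₁.symm (φ.symm z.blowdown)

theorem blowdown_liftedChart (h : IsGluedBlowup p φ₀ E₁ E₂) (hφ : IsCentredChart p φ) (v : V) :
    (liftedChart φ₀ E₁ E₂ p φ v).blowdown = φ (E₁ v) := by
  by_cases hv : E₁ v = p
  · rw [liftedChart, if_pos hv, blowdown_lift_of_eq_zero _ (h.blowdown₂_of_eq hv), hv,
      hφ.map_eq_zero]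
  · rw [liftedChart, if_neg hv, blowdown_point, one_smul]

theorem apply_liftedChartSymm (h : IsGluedBlowup p φ₀ E₁ E₂) (hφ : IsCentredChart p φ)
    {z : BlowupModel 𝕜 m} (hz : z.blowdown ∈ φ.target) :
    E₁ (liftedChartSymm φ₀ E₁ E₂ φ z) = φ.symm z.blowdown := by
  by_cases h0 : z.blowdown = 0
  · rw [liftedChartSymm, if_pos h0, h.apply_symm₂_of_eq_zero (blowdown_lift_of_eq_zero _ h0), h0,
      hφ.symm_zero]
  · rw [liftedChartSymm, if_neg h0, h.apply_symm₁ (hφ.symm_apply_ne hz h0)]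

/-- Coordinate changes between lifted charts are lifts of coordinate changes. -/
theorem liftedChart_liftedChartSymm (h : IsGluedBlowup p φ₀ E₁ E₂) (hφ : IsCentredChart p φ)
    (hψ : IsCentredChart p ψ) {z : BlowupModel 𝕜 m} (hz : z.blowdown ∈ φ.target)
    (hz' : φ.symm z.blowdown ∈ ψ.source) :
    liftedChart φ₀ E₁ E₂ p ψ (liftedChartSymm φ₀ E₁ E₂ φ z) = lift (ψ ∘ φ.symm) z := by
  have hE := h.apply_liftedChartSymm hφ hz
  by_cases h0 : z.blowdown = 0
  -- Over `0` the claim is functoriality of lifts through `φ₀`; elsewhere both sides are `(x, [x])`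
  -- for `x = ψ (φ⁻¹ (blowdown z))`.
  · have hb := blowdown_lift_of_eq_zero (φ₀ ∘ φ.symm) h0
    rw [liftedChart, if_pos (by rw [hE, h0, hφ.symm_zero]), liftedChartSymm, if_pos h0,
      E₂.right_inv (h.mem_target₂ hb), hφ.lift_lift_transition h.centred hψ h0]
  · have hp := hφ.symm_apply_ne hz h0
    rw [liftedChart, if_neg (hE ▸ hp), hE, lift_of_blowdown_ne_zero _ h0]
    exact point_congr_line (hψ.apply_ne_zero hz' hp) _ _ _

theorem liftedChartSymm_liftedChart (h : IsGluedBlowup p φ₀ E₁ E₂) (hφ : IsCentredChart p φ)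
    {v : V} (hv : E₁ v ∈ φ.source) :
    liftedChartSymm φ₀ E₁ E₂ φ (liftedChart φ₀ E₁ E₂ p φ v) = v := by
  have hb := h.blowdown_liftedChart hφ v
  by_cases hp : E₁ v = p
  · have h0 := h.blowdown₂_of_eq hp
    rw [liftedChartSymm, if_pos (by rw [hb, hp, hφ.map_eq_zero]), liftedChart, if_pos hp,
      h.centred.lift_lift_transition hφ h.centred h0, h.centred.lift_transition_self (by
        rw [h0]
        exact h.centred.zero_mem_target), E₂.left_inv (h.mem_source₂_of_eq hp)]
  · rw [liftedChartSymm, if_neg (hb ▸ hφ.apply_ne_zero hv hp), hb, φ.left_inv hv,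
      E₁.left_inv (h.mem_source₁ hp)]

/-- Near the exceptional locus both branches agree with `lift (φ ∘ φ₀.symm) ∘ E₂`, which is smooth
by Hadamard's lemma. Elsewhere only the second branch matters, and there `φ (E₁ v) ≠ 0`. -/
theorem contMDiffOn_liftedChart [T2Space M] (h : IsGluedBlowup p φ₀ E₁ E₂)
    (hφ : IsCentredChart p φ) :
    ContMDiffOn 𝓘(𝕜, EuclideanSpace 𝕜 (Fin m)) 𝓘(𝕜, EuclideanSpace 𝕜 (Fin m)) ∞
      (liftedChart φ₀ E₁ E₂ p φ) (E₁ ⁻¹' φ.source) := by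
  intro v hv
  refine ContMDiffAt.contMDiffWithinAt ?_
  have hcont := h.contMDiff.continuous
  have hφs : ∀ᶠ w in 𝓝 v, E₁ w ∈ φ.source :=
    hcont.continuousAt.preimage_mem_nhds (φ.open_source.mem_nhds hv)
  by_cases hp : E₁ v = p
  · have hs := h.mem_source₂_of_eq hp
    refine ((h.centred.contMDiffAt_lift_transition hφ (h.blowdown₂_of_eq hp)).comp v
      (h.contMDiffOn₂.contMDiffAt (E₂.open_source.mem_nhds hs))).congr_of_eventuallyEq ?_
    filter_upwards [hφs, E₂.open_source.mem_nhds hs] with w hw hw₂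
    by_cases hwp : E₁ w = p
    · exact if_pos hwp
    · have hw₂' : E₁ w ∈ φ₀.source := h.source₂.subset hw₂
      have hb := h.blowdown₂ w hw₂
      rw [liftedChart, if_neg hwp, Function.comp_apply,
        lift_of_blowdown_ne_zero _ (hb ▸ h.centred.apply_ne_zero hw₂' hwp), hb,
        Function.comp_apply, φ₀.left_inv hw₂']
  · refine ((contMDiffAt_point_one (E₂ v).line (hφ.apply_ne_zero hv hp)).comp v
      ((contMDiffAt_of_mem_maximalAtlas hφ.mem_maximalAtlas hv).comp v
        (h.contMDiffAt₁ hp))).congr_of_eventuallyEq ?_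
    filter_upwards [hφs, hcont.continuousAt.eventually_ne hp] with w hw hwp
    rw [liftedChart, if_neg hwp]
    exact point_congr_line (hφ.apply_ne_zero hw hwp) _ _ _

theorem contMDiffOn_liftedChartSymm [T2Space M] (h : IsGluedBlowup p φ₀ E₁ E₂)
    (hφ : IsCentredChart p φ) :
    ContMDiffOn 𝓘(𝕜, EuclideanSpace 𝕜 (Fin m)) 𝓘(𝕜, EuclideanSpace 𝕜 (Fin m)) ∞
      (liftedChartSymm φ₀ E₁ E₂ φ) (blowdown ⁻¹' φ.target) := by
  intro z hz
  refine ContMDiffAt.contMDiffWithinAt ?_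
  have hφt : ∀ᶠ w in 𝓝 z, w.blowdown ∈ φ.target :=
    continuous_blowdown.continuousAt.preimage_mem_nhds (φ.open_target.mem_nhds hz)
  by_cases h0 : z.blowdown = 0
  · have hb := blowdown_lift_of_eq_zero (φ₀ ∘ φ.symm) h0
    have h1 := h.contMDiffOn_symm₂.contMDiffAt (E₂.open_target.mem_nhds (h.mem_target₂ hb))
    refine (h1.comp z (hφ.contMDiffAt_lift_transition h.centred h0)).congr_of_eventuallyEq ?_
    -- Inside `φ₀.source` the branch through `E₁.symm` can be rewritten through `E₂.symm`.
    have hsrc : ∀ᶠ w in 𝓝 z, φ.symm (blowdown w) ∈ φ₀.source := by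
      refine ((φ.continuousAt_symm hz).comp
        continuous_blowdown.continuousAt).preimage_mem_nhds (φ₀.open_source.mem_nhds ?_)
      simpa [h0, hφ.symm_zero] using h.centred.mem_source
    filter_upwards [hφt, hsrc] with w hw hw₂
    by_cases hw0 : w.blowdown = 0
    · exact if_pos hw0
    · have hp := hφ.symm_apply_ne hw hw0
      have hE := h.apply_symm₁ hp
      rw [liftedChartSymm, if_neg hw0, Function.comp_apply, lift_of_blowdown_ne_zero _ hw0,
        Function.comp_apply]
      have := h.apply₂_of_ne w.line (v := E₁.symm (φ.symm w.blowdown)) (by rwa [hE]) (by rwa [hE])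
      rw [hE] at this
      rw [← this, E₂.left_inv (h.mem_source₂ (by rwa [hE]))]
  · have h1 := h.contMDiffOn_symm₁.contMDiffAt (E₁.open_target.mem_nhds
      (show φ.symm z.blowdown ∈ E₁.target from h.target₁ ▸ hφ.symm_apply_ne hz h0))
    have h2 := contMDiffAt_symm_of_mem_maximalAtlas hφ.mem_maximalAtlas hz
    refine (h1.comp z (h2.comp z contMDiff_blowdown.contMDiffAt)).congr_of_eventuallyEq ?_
    filter_upwards [continuous_blowdown.continuousAt.eventually_ne h0] with w hw
    exact if_neg hw

/-- The lift of a chart centred at `p`, as a partial homeomorphism. -/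
theorem exists_isChartLift [T2Space M] (h : IsGluedBlowup p φ₀ E₁ E₂) (hφ : IsCentredChart p φ) :
    ∃ Φ : OpenPartialHomeomorph V (BlowupModel 𝕜 m), IsChartLift E₁ φ Φ ∧
      ⇑Φ = liftedChart φ₀ E₁ E₂ p φ ∧ ⇑Φ.symm = liftedChartSymm φ₀ E₁ E₂ φ :=
  ⟨{  toFun := liftedChart φ₀ E₁ E₂ p φ
      invFun := liftedChartSymm φ₀ E₁ E₂ φ
      source := E₁ ⁻¹' φ.source
      target := blowdown ⁻¹' φ.target
      map_source' := fun v hv => by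
        rw [mem_preimage, h.blowdown_liftedChart hφ]
        exact φ.map_source hv
      map_target' := fun z hz => by
        rw [mem_preimage, h.apply_liftedChartSymm hφ hz]
        exact φ.map_target hz
      left_inv' := fun v hv => h.liftedChartSymm_liftedChart hφ hv
      right_inv' := fun z hz => by
        rw [h.liftedChart_liftedChartSymm hφ hφ hz (φ.map_target hz), hφ.lift_transition_self hz]
      open_source := φ.open_source.preimage h.contMDiff.continuous
      open_target := φ.open_target.preimage continuous_blowdown
      continuousOn_toFun := (h.contMDiffOn_liftedChart hφ).continuousOn
      continuousOn_invFun := (h.contMDiffOn_liftedChartSymm hφ).continuousOn },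
    { source_eq := rfl
      target_eq := rfl
      contMDiffOn_toFun := h.contMDiffOn_liftedChart hφ
      contMDiffOn_symm := h.contMDiffOn_liftedChartSymm hφ
      blowdown_comp := fun v _ => h.blowdown_liftedChart hφ v }, rfl, rfl⟩

theorem exists_forall_isChartLift [T2Space M] (h : IsGluedBlowup p φ₀ E₁ E₂) :
    ∃ L : OpenPartialHomeomorph M (EuclideanSpace 𝕜 (Fin m)) →
        OpenPartialHomeomorph V (BlowupModel 𝕜 m),
      (∀ φ, IsCentredChart p φ → IsChartLift E₁ φ (L φ)) ∧
      ∀ φ ψ, IsCentredChart p φ → IsCentredChart p ψ → ∀ z ∈ (L φ).target,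
        φ.symm z.blowdown ∈ ψ.source → L ψ ((L φ).symm z) = lift (ψ ∘ φ.symm) z := by
  have hL : ∀ φ : OpenPartialHomeomorph M (EuclideanSpace 𝕜 (Fin m)),
      ∃ Φ : OpenPartialHomeomorph V (BlowupModel 𝕜 m), IsCentredChart p φ →
        IsChartLift E₁ φ Φ ∧ ⇑Φ = liftedChart φ₀ E₁ E₂ p φ ∧
          ⇑Φ.symm = liftedChartSymm φ₀ E₁ E₂ φ := by
    intro φ
    by_cases hφ : IsCentredChart p φ
    · obtain ⟨Φ, hΦ⟩ := h.exists_isChartLift hφ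
      exact ⟨Φ, fun _ => hΦ⟩
    -- Charts that are not centred at `p` get an arbitrary value, so that `L` is a total function.
    · exact ⟨E₂, fun hφ' => absurd hφ' hφ⟩
  choose L hL using hL
  refine ⟨L, fun φ hφ => (hL φ hφ).1, fun φ ψ hφ hψ z hz hz' => ?_⟩
  rw [(hL φ hφ).1.target_eq] at hz
  rw [(hL ψ hψ).2.1, (hL φ hφ).2.2]
  exact h.liftedChart_liftedChartSymm hφ hψ hz hz'

end IsGluedBlowup

/-! ### The exceptional locus as a submanifold -/

/-- Inserting a coordinate, as a linear isomorphism. -/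
def insertNthEquivL (𝕜 : Type*) [RCLike 𝕜] (n : ℕ) (j : Fin (n + 1)) :
    (EuclideanSpace 𝕜 (Fin n) × 𝕜) ≃L[𝕜] EuclideanSpace 𝕜 (Fin (n + 1)) :=
  LinearEquiv.toContinuousLinearEquiv
    { toFun := fun w => WithLp.toLp 2 (j.insertNth w.2 (fun i => w.1 i) : Fin (n + 1) → 𝕜)
      invFun := fun x => (WithLp.toLp 2 fun i => x (j.succAbove i), x j)
      map_add' := fun w w' => by
        ext i
        cases i using j.succAboveCases <;> simp
      map_smul' := fun a w => by
        ext i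
        cases i using j.succAboveCases <;> simp
      left_inv := fun w => by simp
      right_inv := fun x => by
        ext i
        cases i using j.succAboveCases <;> simp }

theorem insertNthEquivL_zero {𝕜 : Type*} [RCLike 𝕜] {n : ℕ} (j i : Fin (n + 1))
    (w : EuclideanSpace 𝕜 (Fin n)) : insertNthEquivL 𝕜 n j (w, 0) i =
      if i = j then 0 else Projectivization.insertOne j w i := by
  change (j.insertNth (0 : 𝕜) (fun i => w i) : Fin (n + 1) → 𝕜) i = _
  cases i using j.succAboveCases <;> simp

/-- In the `j`-th charts of projective space and of the model, the zero section inserts `0` as the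
`j`-th coordinate: a linear inclusion with complement `𝕜`. A continuous injection from a compact to
a Hausdorff space is a topological embedding. -/
theorem IsGluedBlowup.isSmoothEmbedding {𝕜 : Type v} [RCLike 𝕜] {n : ℕ} {M : Type u}
    [TopologicalSpace M] [T2Space M] [ChartedSpace (EuclideanSpace 𝕜 (Fin (n + 1))) M]
    {V : Type*} [TopologicalSpace V] [ChartedSpace (EuclideanSpace 𝕜 (Fin (n + 1))) V]
    [IsManifold 𝓘(𝕜, EuclideanSpace 𝕜 (Fin (n + 1))) ∞ V] {p : M}
    {φ₀ : OpenPartialHomeomorph M (EuclideanSpace 𝕜 (Fin (n + 1)))}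
    {E₁ : OpenPartialHomeomorph V M} {E₂ : OpenPartialHomeomorph V (BlowupModel 𝕜 (n + 1))}
    (h : IsGluedBlowup p φ₀ E₁ E₂) :
    IsSmoothEmbedding 𝓘(𝕜, EuclideanSpace 𝕜 (Fin n)) 𝓘(𝕜, EuclideanSpace 𝕜 (Fin (n + 1))) ∞
      (E₂.symm ∘ zeroSection) := by
  have hcont := h.continuous_symm_zeroSection
  have := h.t2Space
  refine ⟨Manifold.IsImmersionOfComplement.isImmersion (F := 𝕜) fun l => ?_,
    (hcont.isClosedEmbedding ?_).isEmbedding⟩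
  · obtain ⟨j, hj⟩ := Projectivization.exists_rep_ne_zero l
    have hmem (l : ℙ 𝕜 (EuclideanSpace 𝕜 (Fin (n + 1)))) : zeroSection l ∈ E₂.target :=
      h.mem_target₂ (blowdown_zeroSection l)
    refine Manifold.IsImmersionAtOfComplement.mk_of_continuousAt hcont.continuousAt
      (insertNthEquivL 𝕜 n j) (Projectivization.affineChart 𝕜 n j)
      (E₂ ≫ₕ chart 𝕜 (n + 1) j) hj ⟨E₂.map_target (hmem l), ?_⟩
      (IsManifold.subset_maximalAtlas (mem_range_self j))
      (OpenPartialHomeomorph.mem_maximalAtlas_of_contMDiffOn _ ?_ ?_) ?_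
    · change E₂ (E₂.symm (zeroSection l)) ∈ (chart 𝕜 (n + 1) j).source
      rw [E₂.right_inv (hmem l)]
      change (zeroSection l).line.rep j ≠ 0
      rwa [line_zeroSection]
    · exact (contMDiffOn_of_mem_maximalAtlas (chart_mem_maximalAtlas j)).comp
        (h.contMDiffOn₂.mono fun v hv => hv.1) fun v hv => hv.2
    · exact h.contMDiffOn_symm₂.comp ((contMDiffOn_symm_of_mem_maximalAtlas
        (chart_mem_maximalAtlas j)).mono fun v hv => hv.1) fun v hv => hv.2
    · intro w _
      change chart 𝕜 (n + 1) j (E₂ (E₂.symm (zeroSection _))) = insertNthEquivL 𝕜 n j (w, 0)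
      rw [E₂.right_inv (hmem _)]
      ext i
      rw [insertNthEquivL_zero]
      change (if i = j then (zeroSection _).blowdown j
        else (zeroSection _).line.rep i / (zeroSection _).line.rep j) = _
      rw [blowdown_zeroSection, line_zeroSection]
      refine if_congr Iff.rfl rfl ?_
      change (Projectivization.mk 𝕜 _ (Projectivization.insertOne_ne_zero j w)).rep i /
        (Projectivization.mk 𝕜 _ (Projectivization.insertOne_ne_zero j w)).rep j = _
      rw [Projectivization.rep_mk_div, Projectivization.insertOne_self, div_one]
  · intro l l' hl
    have := E₂.symm.injOn (h.mem_target₂ (blowdown_zeroSection l))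
      (h.mem_target₂ (blowdown_zeroSection l')) hl
    rw [← line_zeroSection l, this, line_zeroSection]

end Blowup

end

/-! ### The blowup theorem -/

theorem mainTheorem5 {𝕜 : Type v} [RCLike 𝕜] (n : ℕ) {M : Type u}
    [TopologicalSpace M] [T2Space M] [ChartedSpace (EuclideanSpace 𝕜 (Fin (n + 1))) M]
    [IsManifold 𝓘(𝕜, EuclideanSpace 𝕜 (Fin (n + 1))) ∞ M] (p : M) :
    ∃ (V : Type (max u v)) (_ : TopologicalSpace V)
      (_ : ChartedSpace (EuclideanSpace 𝕜 (Fin (n + 1))) V) (q : C(V, M)),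
      -- `V` is a smooth (complex) manifold
      T2Space V ∧ (SecondCountableTopology M → SecondCountableTopology V) ∧
      IsManifold 𝓘(𝕜, EuclideanSpace 𝕜 (Fin (n + 1))) ∞ V ∧
      -- `q` is a smooth (holomorphic) map and a topological blowup of `M` at `p`
      ContMDiff 𝓘(𝕜, EuclideanSpace 𝕜 (Fin (n + 1))) 𝓘(𝕜, EuclideanSpace 𝕜 (Fin (n + 1))) ∞ q ∧
      IsTopologicalBlowup q p ∧
      -- `q` restricts to an isomorphism `V ∖ Σ ≅ M ∖ {p}`
      (∃ Θ : Diffeomorph 𝓘(𝕜, EuclideanSpace 𝕜 (Fin (n + 1)))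
          𝓘(𝕜, EuclideanSpace 𝕜 (Fin (n + 1)))
          (Opens.comap q ⟨{p}ᶜ, isOpen_compl_singleton⟩ : Opens V)
          (⟨{p}ᶜ, isOpen_compl_singleton⟩ : Opens M) ∞,
        ∀ x, ((Θ x : M) = q x)) ∧
      -- `Σ = q ⁻¹' {p}` is a submanifold isomorphic to projective space
      (∃ ι : ℙ 𝕜 (EuclideanSpace 𝕜 (Fin (n + 1))) → V,
        IsSmoothEmbedding 𝓘(𝕜, EuclideanSpace 𝕜 (Fin n))
          𝓘(𝕜, EuclideanSpace 𝕜 (Fin (n + 1))) ∞ ι ∧ range ι = q ⁻¹' {p}) ∧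
      -- charts of `M` centred at `p` lift to the model, and their coordinate changes are the
      -- lifts of the coordinate changes of `M`
      ∃ L : OpenPartialHomeomorph M (EuclideanSpace 𝕜 (Fin (n + 1))) →
          OpenPartialHomeomorph V (BlowupModel 𝕜 (n + 1)),
        (∀ φ ∈ IsManifold.maximalAtlas 𝓘(𝕜, EuclideanSpace 𝕜 (Fin (n + 1))) ∞ M,
          p ∈ φ.source → φ p = 0 → IsChartLift q φ (L φ)) ∧
        ∀ φ ∈ IsManifold.maximalAtlas 𝓘(𝕜, EuclideanSpace 𝕜 (Fin (n + 1))) ∞ M,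
          ∀ ψ ∈ IsManifold.maximalAtlas 𝓘(𝕜, EuclideanSpace 𝕜 (Fin (n + 1))) ∞ M,
            p ∈ φ.source → φ p = 0 → p ∈ ψ.source → ψ p = 0 →
            ∀ z ∈ (L φ).target, φ.symm z.blowdown ∈ ψ.source →
              L ψ ((L φ).symm z) = BlowupModel.lift (ψ ∘ φ.symm) z := by
  obtain ⟨l⟩ : Nonempty (ℙ 𝕜 (EuclideanSpace 𝕜 (Fin (n + 1)))) := inferInstance
  obtain ⟨V, tV, cV, φ₀, E₁, E₂, hV, h⟩ := exists_isGluedBlowup 𝕜 (n + 1) p l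
  obtain ⟨L, hL, hL'⟩ := h.exists_forall_isChartLift
  have hrange := h.range_symm_zeroSection
  refine ⟨V, tV, cV, ⟨E₁, h.contMDiff.continuous⟩, h.t2Space,
    fun _ => h.secondCountableTopology, hV, h.contMDiff, ⟨h.isQuotientMap l, ?_, ?_, ?_⟩,
    ⟨h.diffeomorph, fun _ => rfl⟩, ⟨_, h.isSmoothEmbedding, hrange⟩, L,
    fun φ hφ hp h0 => hL φ ⟨hφ, hp, h0⟩,
    fun φ hφ ψ hψ hp h0 hp' h0' => hL' φ ψ ⟨hφ, hp, h0⟩ ⟨hψ, hp', h0'⟩⟩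
  -- Connectedness and compactness pass from projective space to its image `Σ`.
  · exact hrange ▸ isConnected_range h.continuous_symm_zeroSection
  · exact hrange ▸ isCompact_range h.continuous_symm_zeroSection
  · exact h.diffeomorph.toHomeomorph.isHomeomorph
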